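/- Let $s\ge 1$ be an integer, $g:[0,1]^s\to\mathbb R$ and $a<b$. Let $X=g(\mathbf U)$, with $\mathbf U$ uniform on $[0,1]^s$, have density $f\ge 0$ with respect to Lebesgue measure on $\mathbb R$. For $\mathfrak v\subseteq\{1,\dots,s\}$ write $g_{\mathfrak v}=\partial^{|\mathfrak v|}g/\partial\mathbf u_{\mathfrak v}$ (one derivative in each coordinate of $\mathfrak v$, one-sided on the boundary of the cube; taking these derivatives in one fixed order of the coordinates suffices below). Assume the following. 1. $k:\mathbb R\to[0,\infty)$ is a probability density, symmetric about $0$, nondecreasing on $(-\infty,0]$, nonincreasing on $[0,\infty)$, with $0<\int x^2k(x)\,dx<\infty$; it is $s$ times continuously differentiable, and its derivatives of order $0,\dots,s$ are integrable and bounded on $\mathbb R$. 2. $f$ is four times (two-sidedly) differentiable at every point of $[a,b]$, endpoints included, and $\int_a^b (f^{(r)}(x))^2\,dx<\infty$ for $0\le r\le 4$. 3. For each $j$ there is an integer $M_j$ such that, for any fixed values of the other coordinates, $u_j\mapsto g(\mathbf u)$ is piecewise monotone on $[0,1]$ with at most $M_j$ monotone pieces; all $g_{\mathfrak v}$ exist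 and are bounded on $[0,1]^s$, and the first-order partial derivatives of $g$ are continuous on $[0,1]^s$. 4. For each $n\ge 1$, $P_n=(\mathbf U_{1},\dots,\mathbf U_{n})$ are (possibly dependent) random points, each uniformly distributed on $[0,1]^s$, and for every $\epsilon>0$ there is a deterministic constant $K$ such that for all $n\ge 1$, almost surely, the star discrepancy $$D^*(P_n)=\sup_{\mathbf u\in[0,1]^s}\Bigl|\prod_{j=1}^s u_j-\tfrac1n\#\{i:\mathbf U_i\in[\mathbf 0,\mathbf u)\}\Bigr|$$ is at most $K n^{-1+\epsilon}$. For $h>0$ let $\hat f_n(x)=\frac1{nh}\sum_{i=1}^n k\bigl((x-g(\mathbf U_i))/h\bigr)$, $$\mathrm{IV}(n,h)=\int_a^b \mathbb E\bigl(\hat f_n(x)-\mathbb E\hat f_n(x)\bigr)^2dx,\qquad \mathrm{MISE}(n,h)=\int_a^b\mathbb E\bigl(\hat f_n(x)-f(x)\bigr)^2dx .$$ Then for every $\epsilon>0$ there is a constant $K$ such that, for all $n\ge 1$ and all $h\in(0,1]$, $$\mathrm{IV}(n,h)\le K\,n^{-2+\epsilon}h^{-2s}.$$ Moreover, for bandwidths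 $h_n>0$ with $h_n=\Theta(n^{-1/(2+s)})$ as $n\to\infty$ and every $\epsilon>0$, there is a constant $K$ such that for all $n\ge1$ $$\mathrm{MISE}(n,h_n)\le K\,n^{-4/(2+s)+\epsilon}.$$ The exponent $-4/(2+s)$ is smaller than the exponent $-4/5$ of the Monte Carlo rate if and only if $s<3$, and equal to it if and only if $s=3$; in particular, if $s<3$ then $\mathrm{MISE}(n,h_n)=O(n^{-4/5-\delta})$ for some $\delta>0$. -/

import Mathlib

open MeasureTheory ProbabilityTheory Filter Topology Asymptotics

noncomputable section

/-- The closed unit hypercube `[0,1]^s`. -/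
def cube (s : ℕ) : Set (Fin s → ℝ) := Set.Icc 0 1

/-- The uniform distribution on `[0,1]^s`. -/
def uniformCube (s : ℕ) : Measure (Fin s → ℝ) := volume.restrict (cube s)

/-! ### Partial derivatives on the cube -/

/-- The function of one variable obtained from `φ` by letting the `j`-th coordinate of `u` vary. -/
def coordLine {s : ℕ} (φ : (Fin s → ℝ) → ℝ) (u : Fin s → ℝ) (j : Fin s) : ℝ → ℝ :=
  fun t => φ (Function.update u j t)

/-- The partial derivative of `φ` in the `j`-th coordinate exists at `u`
(it is one-sided when `u j` is `0` or `1`). -/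
def HasPartial {s : ℕ} (j : Fin s) (φ : (Fin s → ℝ) → ℝ) (u : Fin s → ℝ) : Prop :=
  DifferentiableWithinAt ℝ (coordLine φ u j) (Set.Icc 0 1) (u j)

/-- The partial derivative `∂φ/∂u_j` of a function on the cube. -/
def partialD {s : ℕ} (j : Fin s) (φ : (Fin s → ℝ) → ℝ) : (Fin s → ℝ) → ℝ :=
  fun u => derivWithin (coordLine φ u j) (Set.Icc 0 1) (u j)

/-- The mixed partial derivative `g_v = ∂^{|v|} g / ∂u_v`, once in each coordinate of `v`:
`g_v = ∂_{j₁} ∂_{j₂} ⋯ ∂_{jₘ} g` for `v = {j₁ < j₂ < ⋯ < jₘ}`. -/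
def mixedPartial {s : ℕ} (v : Finset (Fin s)) (g : (Fin s → ℝ) → ℝ) : (Fin s → ℝ) → ℝ :=
  (v.sort (· ≤ ·)).foldr partialD g

/-- `φ` is piecewise monotone on `[0,1]` with at most `M` monotone pieces. -/
def PiecewiseMonotone (M : ℕ) (φ : ℝ → ℝ) : Prop :=
  ∃ p : ℕ → ℝ, Monotone p ∧ p 0 = 0 ∧ p M = 1 ∧
    ∀ i < M, MonotoneOn φ (Set.Icc (p i) (p (i + 1))) ∨ AntitoneOn φ (Set.Icc (p i) (p (i + 1)))

/-! ### Assumptions on the kernel, on the density and on the simulated function -/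

/-- The kernel is a probability density, symmetric about `0`, nondecreasing on `(-∞,0]` and
nonincreasing on `[0,∞)`, with positive finite second moment. -/
structure IsKernel (k : ℝ → ℝ) : Prop where
  nonneg : ∀ x, 0 ≤ k x
  integrable : Integrable k
  integral_eq_one : ∫ x, k x = 1
  symm : ∀ x, k (-x) = k x
  monotoneOn : MonotoneOn k (Set.Iic 0)
  antitoneOn : AntitoneOn k (Set.Ici 0)
  integrable_sq : Integrable fun x => x ^ 2 * k x
  second_moment_pos : 0 < ∫ x, x ^ 2 * k x

/-- The kernel is `s` times continuously differentiable, and its derivatives up to order `s` are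
integrable and bounded on `ℝ`. -/
structure IsSmoothKernel (s : ℕ) (k : ℝ → ℝ) : Prop where
  contDiff : ContDiff ℝ s k
  integrable : ∀ r ≤ s, Integrable (iteratedDeriv r k)
  bounded : ∀ r ≤ s, ∃ C : ℝ, ∀ x, |iteratedDeriv r k x| ≤ C

/-- `f` is four times differentiable at `x`: its derivatives of order at most `3` exist near `x`,
and the third one is differentiable at `x`. -/
def FourTimesDifferentiableAt (f : ℝ → ℝ) (x : ℝ) : Prop :=
  (∀ r < 3, ∀ᶠ y in 𝓝 x, DifferentiableAt ℝ (iteratedDeriv r f) y) ∧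
    DifferentiableAt ℝ (iteratedDeriv 3 f) x

/-- `f` is four times differentiable at each point of `[a,b]`, and the roughness
`∫_a^b (f^{(r)})²` is finite for `r ≤ 4`. -/
structure IsSmoothDensityOn (a b : ℝ) (f : ℝ → ℝ) : Prop where
  differentiable : ∀ x ∈ Set.Icc a b, FourTimesDifferentiableAt f x
  roughness : ∀ r ≤ 4, IntegrableOn (fun x => iteratedDeriv r f x ^ 2) (Set.Icc a b)

/-- `X = g(U)`, with `U` uniform on `[0,1]^s`, has density `f` with respect to Lebesgue measure. -/
structure HasDensity {s : ℕ} (g : (Fin s → ℝ) → ℝ) (f : ℝ → ℝ) : Prop where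
  measurable : Measurable f
  nonneg : ∀ x, 0 ≤ f x
  hasLaw : HasLaw g (volume.withDensity fun x => ENNReal.ofReal (f x)) (uniformCube s)

/-- `g` is piecewise monotone in each coordinate, with a uniformly bounded number of pieces; all
mixed partial derivatives `g_v` exist on the cube and are bounded there, and those of first order
are continuous. -/
structure IsRegularMap {s : ℕ} (g : (Fin s → ℝ) → ℝ) : Prop where
  piecewiseMonotone : ∀ j, ∃ M : ℕ, ∀ u ∈ cube s, PiecewiseMonotone M (coordLine g u j)
  /-- Existence of every `g_v`: `g_w` can be differentiated in each coordinate `j < min w`. -/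
  hasPartial : ∀ (w : Finset (Fin s)) (j : Fin s), (∀ i ∈ w, j < i) →
    ∀ u ∈ cube s, HasPartial j (mixedPartial w g) u
  /-- Existence of the first-order partial derivatives is the case `w = ∅` above. -/
  continuous_first : ∀ j, ContinuousOn (partialD j g) (cube s)
  bounded : ∀ v : Finset (Fin s), ∃ C : ℝ, ∀ u ∈ cube s, |mixedPartial v g u| ≤ C

/-! ### Point sets -/

/-- The star discrepancy of `n` points (counted with multiplicity):
`sup_{u ∈ [0,1]^s} |vol [0,u) - #{i : p_i ∈ [0,u)} / n|`. -/
def starDiscrepancy {s n : ℕ} (p : Fin n → Fin s → ℝ) : ℝ :=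
  ⨆ u : cube s, |∏ j, (u : Fin s → ℝ) j -
    (({i : Fin n | ∀ j, p i j ∈ Set.Ico 0 ((u : Fin s → ℝ) j)}.ncard : ℕ) : ℝ) / n|

/-- RQMC point sets `P_n` of `n` random points, `n ≥ 1`: each individual point is uniformly
distributed on `[0,1]^s` (with no assumption on the dependence between the points), and for all
`ε > 0` the star discrepancy of the realized points is almost surely at most `K n^{-1+ε}`, with a
deterministic `K` that does not depend on `n`. -/
structure IsLowDiscrepancyRQMC {Ω : Type*} [MeasurableSpace Ω] (μ : Measure Ω) {s : ℕ}
    (P : (n : ℕ) → Fin n → Ω → (Fin s → ℝ)) : Prop where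
  hasLaw : ∀ n i, HasLaw (P n i) (uniformCube s) μ
  discrepancy : ∀ ε > (0 : ℝ), ∃ K : ℝ, ∀ n : ℕ, 1 ≤ n →
    ∀ᵐ ω ∂μ, starDiscrepancy (fun i => P n i ω) ≤ K * (n : ℝ) ^ (-1 + ε)

/-! ### The kernel density estimator and its errors -/

/-- The kernel density estimator at `x`, with bandwidth `h`, from the observations `X i`. -/
def kde {n : ℕ} (k : ℝ → ℝ) (h : ℝ) (X : Fin n → ℝ) (x : ℝ) : ℝ :=
  1 / (n * h) * ∑ i, k ((x - X i) / h)

/-- The integrated variance over `[a,b]` of the kernel density estimator based on the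
observations `g(U_1), …, g(U_n)`, where `U_i = p i`. -/
def integratedVariance {Ω : Type*} [MeasurableSpace Ω] (μ : Measure Ω) {s n : ℕ}
    (k : ℝ → ℝ) (g : (Fin s → ℝ) → ℝ) (a b : ℝ) (p : Fin n → Ω → (Fin s → ℝ)) (h : ℝ) :
    ENNReal :=
  ∫⁻ x in Set.Icc a b, evariance (fun ω => kde k h (fun i => g (p i ω)) x) μ

/-- The mean integrated square error over `[a,b]` of the same estimator, as an estimator
of `f`. -/
def meanIntegratedSquareError {Ω : Type*} [MeasurableSpace Ω] (μ : Measure Ω) {s n : ℕ}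
    (k : ℝ → ℝ) (g : (Fin s → ℝ) → ℝ) (f : ℝ → ℝ) (a b : ℝ) (p : Fin n → Ω → (Fin s → ℝ))
    (h : ℝ) : ENNReal :=
  ∫⁻ x in Set.Icc a b, ∫⁻ ω, ENNReal.ofReal ((kde k h (fun i => g (p i ω)) x - f x) ^ 2) ∂μ

end

/-! ### Calculus on the cube -/

section CubeCalculus

variable {s : ℕ}

/-! For fixed `x`, the estimator minus its mean is the quasi-Monte Carlo integration error of `u ↦
h⁻¹ k((x - g u)/h)`. The Koksma–Hlawka inequality (`koksma_hlawka`) bounds it by the star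
discrepancy times the sum, over nonempty `v`, of the integrals of `|∂_v|` on the faces where the
coordinates outside `v` equal 1.

By a Faà di Bruno formula (`exists_faaDiBruno`), `∂_v k((x - g)/h)` is a sum over `r ≤ |v|` of
`h^{-r} k^{(r)}((x - g)/h) Q_r`, with bounded `Q_r`. The terms `r < |v|` are `O(h^{1-|v|})`. The
term `r = |v|` looks worse by one power of `h`, but its coefficient contains a factor `∂_j g`.
Integrating along direction `j` and changing variables to `y = g` on each of the at most `M_j`
monotone pieces gains a factor `h` (`integral_line_le`). The face integrals are thus `O(h^{1-s})`,
and the error is at most `C D* h^{-s}` almost surely, with `C` independent of `x`. Squaring gives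
the integrated variance.

The bias is `O(h²)` uniformly on `[a,b]` (`exists_bias_le`): near `x` by a Taylor expansion and the
symmetry of `k`, and far from `x`, where `f` is only known to be nonnegative and integrable, by the
tail bound `k(z) |z|³ ≤ 8 ∫ x² k`. With `h ≍ n^{-1/(2+s)}` the terms `n^{-2} h^{-2s}` and `h⁴` are
both of order `n^{-4/(2+s)}`. -/

theorem mem_cube_iff {u : Fin s → ℝ} : u ∈ cube s ↔ ∀ i, u i ∈ Set.Icc (0 : ℝ) 1 := by
  simp only [cube, Set.mem_Icc, Pi.le_def, Pi.zero_apply, Pi.one_apply]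
  exact ⟨fun h i => ⟨h.1 i, h.2 i⟩, fun h => ⟨fun i => (h i).1, fun i => (h i).2⟩⟩

theorem cube_eq_pi : cube s = Set.univ.pi fun _ => Set.Icc (0 : ℝ) 1 := by
  ext u; simp only [mem_cube_iff, Set.mem_univ_pi]

theorem measurableSet_cube : MeasurableSet (cube s) := measurableSet_Icc

theorem update_mem_cube {u : Fin s → ℝ} (hu : u ∈ cube s) (j : Fin s) {t : ℝ}
    (ht : t ∈ Set.Icc (0 : ℝ) 1) : Function.update u j t ∈ cube s := by
  rw [mem_cube_iff] at *
  intro i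
  rcases eq_or_ne i j with rfl | h
  · simpa using ht
  · simpa [h] using hu i

theorem piecewise_mem_cube {u u' : Fin s → ℝ} (hu : u ∈ cube s) (hu' : u' ∈ cube s)
    (v : Finset (Fin s)) : v.piecewise u u' ∈ cube s := by
  rw [mem_cube_iff] at *
  intro i
  by_cases h : i ∈ v <;> simp [h, hu i, hu' i, -Set.mem_Icc]

theorem one_mem_cube : (1 : Fin s → ℝ) ∈ cube s := by simp [mem_cube_iff]

theorem uniformCube_eq_pi :
    uniformCube s = Measure.pi fun _ => (volume : Measure ℝ).restrict (Set.Icc 0 1) := by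
  rw [uniformCube, cube_eq_pi, volume_pi, Measure.restrict_pi_pi]

instance isProbabilityMeasure_uniformCube : IsProbabilityMeasure (uniformCube s) := by
  have : IsProbabilityMeasure ((volume : Measure ℝ).restrict (Set.Icc 0 1)) := ⟨by simp⟩
  rw [uniformCube_eq_pi]
  infer_instance

instance isProbabilityMeasure_restrict_Icc_zero_one :
    IsProbabilityMeasure ((volume : Measure ℝ).restrict (Set.Icc 0 1)) := ⟨by simp⟩

theorem ae_uniformCube_mem : ∀ᵐ u ∂uniformCube s, u ∈ cube s :=
  ae_restrict_mem measurableSet_cube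

/-- Resampling one coordinate of a uniform point gives a uniform point. -/
theorem measurePreserving_update (j : Fin s) :
    MeasurePreserving (fun q : (Fin s → ℝ) × ℝ => Function.update q.1 j q.2)
      ((uniformCube s).prod (volume.restrict (Set.Icc 0 1))) (uniformCube s) := by
  refine ⟨measurable_update', ?_⟩
  conv_rhs => rw [uniformCube_eq_pi]
  symm
  refine Measure.pi_eq fun S hS => ?_
  rw [Measure.map_apply measurable_update' (MeasurableSet.univ_pi hS)]
  have h1 : (fun q : (Fin s → ℝ) × ℝ => Function.update q.1 j q.2) ⁻¹' Set.univ.pi S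
      = (Set.univ.pi (Function.update S j Set.univ)) ×ˢ S j := by
    ext ⟨u, t⟩
    simp only [Set.mem_preimage, Set.mem_univ_pi, Set.mem_prod]
    constructor
    · intro h
      refine ⟨fun i => ?_, by simpa using h j⟩
      rcases eq_or_ne i j with rfl | hij
      · simp
      · simpa [hij] using h i
    · rintro ⟨h, h'⟩ i
      rcases eq_or_ne i j with rfl | hij
      · simpa using h'
      · simpa [hij] using h i
  rw [h1, Measure.prod_prod, uniformCube_eq_pi, Measure.pi_pi,
    ← Finset.mul_prod_erase _ _ (Finset.mem_univ j),
    ← Finset.mul_prod_erase (Finset.univ) (fun i => (volume.restrict (Set.Icc (0 : ℝ) 1)) (S i))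
      (Finset.mem_univ j), Function.update_self, measure_univ, one_mul, mul_comm]
  congr 1
  refine Finset.prod_congr rfl fun i hi => ?_
  rw [Function.update_of_ne (Finset.ne_of_mem_erase hi)]

theorem integral_integral_update (j : Fin s) {G : (Fin s → ℝ) → ℝ} (hG : Measurable G)
    (hint : Integrable G (uniformCube s)) :
    ∫ u, (∫ t in Set.Icc 0 1, G (Function.update u j t)) ∂uniformCube s
      = ∫ u, G u ∂uniformCube s := by
  have hmp := measurePreserving_update j
  have h := (hmp.integrable_comp hG.aestronglyMeasurable).2 hint
  conv_rhs =>
    rw [← hmp.map_eq, integral_map hmp.measurable.aemeasurable hG.aestronglyMeasurable]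
  exact (integral_prod _ h).symm

theorem coordLine_update (φ : (Fin s → ℝ) → ℝ) (u : Fin s → ℝ) (j : Fin s) (t : ℝ) :
    coordLine φ (Function.update u j t) j = coordLine φ u j := by
  ext r; simp [coordLine]

theorem hasDerivWithinAt_coordLine {φ : (Fin s → ℝ) → ℝ} {j : Fin s}
    (h : ∀ u ∈ cube s, HasPartial j φ u) {u : Fin s → ℝ} (hu : u ∈ cube s) {t : ℝ}
    (ht : t ∈ Set.Icc (0 : ℝ) 1) :
    HasDerivWithinAt (coordLine φ u j) (partialD j φ (Function.update u j t)) (Set.Icc 0 1) t := by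
  have := (h _ (update_mem_cube hu j ht)).hasDerivWithinAt
  simpa [coordLine_update, partialD] using this

theorem coordLine_self (φ : (Fin s → ℝ) → ℝ) (u : Fin s → ℝ) (j : Fin s) :
    coordLine φ u j (u j) = φ u := by simp [coordLine]

theorem partialD_eq_of_hasDerivWithinAt {φ : (Fin s → ℝ) → ℝ} {j : Fin s} {u : Fin s → ℝ}
    {d : ℝ} (hu : u ∈ cube s) (h : HasDerivWithinAt (coordLine φ u j) d (Set.Icc 0 1) (u j)) :
    partialD j φ u = d :=
  h.derivWithin (uniqueDiffOn_Icc zero_lt_one _ (mem_cube_iff.1 hu j))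

/-- A point of `[0,1]` at distance `1/(n+2)` of `t`. -/
noncomputable def inwardShift (n : ℕ) (t : ℝ) : ℝ :=
  if t < 1 / 2 then t + 1 / ((n : ℝ) + 2) else t - 1 / ((n : ℝ) + 2)

theorem measurable_inwardShift (n : ℕ) : Measurable (inwardShift n) :=
  Measurable.ite measurableSet_Iio (by fun_prop) (by fun_prop)

theorem inwardShift_mem (n : ℕ) {t : ℝ} (ht : t ∈ Set.Icc (0 : ℝ) 1) :
    inwardShift n t ∈ Set.Icc (0 : ℝ) 1 \ {t} := by
  have h0 : (0 : ℝ) < 1 / ((n : ℝ) + 2) := by positivity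
  have h1 : 1 / ((n : ℝ) + 2) ≤ 1 / 2 := by
    apply one_div_le_one_div_of_le <;> linarith [(Nat.cast_nonneg n : (0 : ℝ) ≤ n)]
  obtain ⟨ht0, ht1⟩ := ht
  unfold inwardShift
  split_ifs with h
  · exact ⟨⟨by linarith, by linarith⟩, by simp; positivity⟩
  · exact ⟨⟨by linarith, by linarith⟩, by simp; positivity⟩

theorem tendsto_inwardShift (t : ℝ) : Tendsto (fun n => inwardShift n t) atTop (𝓝 t) := by
  have h : Tendsto (fun n : ℕ => 1 / ((n : ℝ) + 2)) atTop (𝓝 0) := by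
    have h2 := tendsto_one_div_add_atTop_nhds_zero_nat (𝕜 := ℝ)
    have h3 := h2.comp (tendsto_add_atTop_nat 1)
    refine h3.congr fun n => ?_
    simp only [Function.comp, Nat.cast_add, Nat.cast_one]; ring
  unfold inwardShift
  split_ifs
  · simpa using h.const_add t
  · simpa using h.const_sub t

/-- Partial derivatives of measurable functions on the cube are measurable. -/
theorem measurable_indicator_partialD {φ : (Fin s → ℝ) → ℝ} {j : Fin s}
    (hm : Measurable ((cube s).indicator φ)) (h : ∀ u ∈ cube s, HasPartial j φ u) :
    Measurable ((cube s).indicator (partialD j φ)) := by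
  set ψ := (cube s).indicator φ with hψ
  -- The derivative is the pointwise limit of measurable difference quotients whose increments point
  -- into `[0,1]`, so boundary points need no separate treatment.
  let q : ℕ → (Fin s → ℝ) → ℝ := fun n u =>
    (inwardShift n (u j) - u j)⁻¹ * (ψ (Function.update u j (inwardShift n (u j))) - ψ u)
  have hq : ∀ n, Measurable ((cube s).indicator (q n)) := by
    intro n
    have hs : Measurable fun u : Fin s → ℝ => inwardShift n (u j) :=
      (measurable_inwardShift n).comp (measurable_pi_apply j)
    refine Measurable.indicator ?_ measurableSet_cube
    refine ((hs.sub (measurable_pi_apply j)).inv).mul ((hm.comp ?_).sub hm)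
    exact (measurable_update' (a := j)).comp (measurable_id.prodMk hs)
  refine measurable_of_tendsto_metrizable hq ?_
  rw [tendsto_pi_nhds]
  intro u
  by_cases hu : u ∈ cube s
  · simp only [Set.indicator_of_mem hu]
    have hd := hasDerivWithinAt_coordLine h hu (mem_cube_iff.1 hu j)
    rw [Function.update_eq_self, hasDerivWithinAt_iff_tendsto_slope] at hd
    have ht : Tendsto (fun n => inwardShift n (u j)) atTop (𝓝[Set.Icc 0 1 \ {u j}] (u j)) :=
      tendsto_nhdsWithin_iff.2 ⟨tendsto_inwardShift _,
        Eventually.of_forall fun n => inwardShift_mem n (mem_cube_iff.1 hu j)⟩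
    refine (hd.comp ht).congr fun n => ?_
    have hmem := update_mem_cube hu j (inwardShift_mem n (mem_cube_iff.1 hu j)).1
    simp only [Function.comp, slope_def_field, Function.update_eq_self, q, hψ, Set.indicator_of_mem hu,
      Set.indicator_of_mem hmem, coordLine]
    rw [div_eq_inv_mul]
  · simp [Set.indicator_of_notMem hu]

/-! ### Mixed partial derivatives and integration in one coordinate. -/

theorem mixedPartial_empty (F : (Fin s → ℝ) → ℝ) : mixedPartial ∅ F = F := by
  simp [mixedPartial]

/-- The smallest coordinate is differentiated last, so inductions on `v` must add a new minimum. -/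
theorem mixedPartial_insert (F : (Fin s → ℝ) → ℝ) {v : Finset (Fin s)} {j : Fin s}
    (h : ∀ i ∈ v, j < i) : mixedPartial (insert j v) F = partialD j (mixedPartial v F) := by
  unfold mixedPartial
  rw [Finset.sort_insert (· ≤ ·) (fun i hi => (h i hi).le) fun hj => lt_irrefl _ (h j hj)]
  rfl

theorem mixedPartial_singleton (F : (Fin s → ℝ) → ℝ) (j : Fin s) :
    mixedPartial {j} F = partialD j F := by
  have := mixedPartial_insert F (v := ∅) (j := j) (by simp)
  rwa [mixedPartial_empty, insert_empty_eq] at this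

/-- Induction on finite sets of coordinates, adding a new smallest element. -/
theorem finset_induction_min {p : Finset (Fin s) → Prop} (h0 : p ∅)
    (h1 : ∀ (v : Finset (Fin s)) (j : Fin s), (∀ i ∈ v, j < i) → p v → p (insert j v))
    (v : Finset (Fin s)) : p v :=
  Finset.induction_on_min v h0 fun j v hj hv => h1 v j hj hv

/-- `F` is measurable on the cube, and has there all mixed partial derivatives
(in decreasing order of the coordinates), which are bounded. -/
structure HasBoundedMixedPartials (F : (Fin s → ℝ) → ℝ) : Prop where
  measurable : Measurable ((cube s).indicator F)
  hasPartial : ∀ (w : Finset (Fin s)) (j : Fin s), (∀ i ∈ w, j < i) →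
    ∀ u ∈ cube s, HasPartial j (mixedPartial w F) u
  bounded : ∀ v : Finset (Fin s), ∃ C : ℝ, ∀ u ∈ cube s, |mixedPartial v F u| ≤ C

/-- The mixed partial derivative, extended by zero outside the cube. -/
noncomputable def mixedExt (v : Finset (Fin s)) (F : (Fin s → ℝ) → ℝ) : (Fin s → ℝ) → ℝ :=
  (cube s).indicator (mixedPartial v F)

variable {F : (Fin s → ℝ) → ℝ}

theorem HasBoundedMixedPartials.measurable_mixedExt (hF : HasBoundedMixedPartials F)
    (v : Finset (Fin s)) : Measurable (mixedExt v F) := by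
  unfold mixedExt
  induction v using finset_induction_min with
  | h0 => simpa [mixedPartial_empty] using hF.measurable
  | h1 v j hj ih =>
    rw [mixedPartial_insert F hj]
    exact measurable_indicator_partialD ih (hF.hasPartial v j hj)

theorem HasBoundedMixedPartials.exists_bound (hF : HasBoundedMixedPartials F)
    (v : Finset (Fin s)) : ∃ C : ℝ, ∀ u, |mixedExt v F u| ≤ C := by
  obtain ⟨C, hC⟩ := hF.bounded v
  refine ⟨max C 0, fun u => ?_⟩
  by_cases hu : u ∈ cube s
  · simpa [mixedExt, hu] using Or.inl (hC u hu)
  · simp [mixedExt, hu]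

theorem mixedExt_of_mem {v : Finset (Fin s)} {u : Fin s → ℝ} (hu : u ∈ cube s) :
    mixedExt v F u = mixedPartial v F u := Set.indicator_of_mem hu _

/-- The indicator function of `p < t`. -/
noncomputable def ltInd (p t : ℝ) : ℝ := if p < t then 1 else 0

theorem measurable_ltInd : Measurable fun q : ℝ × ℝ => ltInd q.1 q.2 :=
  Measurable.ite (measurableSet_lt measurable_fst measurable_snd) measurable_const
    measurable_const

theorem abs_ltInd_le (p t : ℝ) : |ltInd p t| ≤ 1 := by
  unfold ltInd; split_ifs <;> simp

/-- Fundamental theorem of calculus in one coordinate. -/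
theorem HasBoundedMixedPartials.ftc (hF : HasBoundedMixedPartials F) {v : Finset (Fin s)}
    {j : Fin s} (hj : ∀ i ∈ v, j < i) {u : Fin s → ℝ} (hu : u ∈ cube s) :
    mixedExt v F u = mixedExt v F (Function.update u j 1) -
      ∫ t in Set.Icc 0 1, ltInd (u j) t * mixedExt (insert j v) F (Function.update u j t) := by
  have huj := mem_cube_iff.1 hu j
  have h1 : (1 : ℝ) ∈ Set.Icc (0 : ℝ) 1 := by simp
  set f' : ℝ → ℝ := fun t => mixedExt (insert j v) F (Function.update u j t) with hf'
  have hm : Measurable f' :=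
    (hF.measurable_mixedExt _).comp (measurable_update u)
  obtain ⟨C, hC⟩ := hF.exists_bound (insert j v)
  have hint : ∀ a b, IntervalIntegrable f' volume a b := fun a b =>
    ⟨Measure.integrableOn_of_bounded (M := C) (by simp) hm.aestronglyMeasurable
      (Eventually.of_forall fun t => hC _), Measure.integrableOn_of_bounded (M := C) (by simp)
      hm.aestronglyMeasurable (Eventually.of_forall fun t => hC _)⟩
  have hder : ∀ t ∈ Set.Icc (0 : ℝ) 1,
      HasDerivWithinAt (coordLine (mixedPartial v F) u j) (f' t) (Set.Icc 0 1) t := by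
    intro t ht
    rw [hf']
    simp only
    rw [mixedExt_of_mem (update_mem_cube hu j ht), mixedPartial_insert F hj]
    exact hasDerivWithinAt_coordLine (hF.hasPartial v j hj) hu ht
  -- This version asks only for an integrable derivative. Boundedness and measurability provide
  -- that; the mixed partials may be discontinuous.
  have hftc := intervalIntegral.integral_eq_sub_of_hasDerivAt_of_le
    (f := coordLine (mixedPartial v F) u j) (f' := f') huj.2
    (fun t ht => ((hder t ⟨huj.1.trans ht.1, ht.2⟩).continuousWithinAt).mono
      (Set.Icc_subset_Icc_left huj.1))
    (fun t ht => (hder t ⟨huj.1.trans ht.1.le, ht.2.le⟩).hasDerivAt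
      (Icc_mem_nhds (huj.1.trans_lt ht.1) ht.2)) (hint _ _)
  -- The indicator moves the dependence on `u j` from the domain into the integrand, so that the
  -- integral can later be merged into one over the whole cube.
  have hset : ∫ t in Set.Icc 0 1, ltInd (u j) t * f' t = ∫ t in (u j)..1, f' t := by
    rw [intervalIntegral.integral_of_le huj.2]
    have : ∀ t, ltInd (u j) t * f' t = (Set.Ioi (u j)).indicator f' t := by
      intro t
      by_cases h : u j < t <;> simp [ltInd, h]
    simp_rw [this]
    rw [setIntegral_indicator measurableSet_Ioi]
    congr 2
    ext t
    simp only [Set.mem_inter_iff, Set.mem_Icc, Set.mem_Ioi, Set.mem_Ioc]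
    constructor
    · rintro ⟨⟨_, h⟩, h'⟩; exact ⟨h', h⟩
    · rintro ⟨h', h⟩; exact ⟨⟨huj.1.trans h'.le, h⟩, h'⟩
  rw [hset, hftc, mixedExt_of_mem hu, mixedExt_of_mem (update_mem_cube hu j h1), coordLine_self]
  simp [coordLine]

end CubeCalculus

/-! ### The Koksma–Hlawka inequality -/

section KoksmaHlawka

variable {s : ℕ} {F : (Fin s → ℝ) → ℝ}

/-- The indicator function of `p i < u i` for all `i ∈ v`. -/
noncomputable def ltIndProd (v : Finset (Fin s)) (p u : Fin s → ℝ) : ℝ :=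
  ∏ i ∈ v, ltInd (p i) (u i)

theorem measurable_ltIndProd (v : Finset (Fin s)) :
    Measurable fun q : (Fin s → ℝ) × (Fin s → ℝ) => ltIndProd v q.1 q.2 := by
  refine Finset.measurable_fun_prod v fun i _ => ?_
  have h : Measurable fun q : (Fin s → ℝ) × (Fin s → ℝ) => (q.1 i, q.2 i) := by fun_prop
  exact measurable_ltInd.comp h

theorem abs_ltIndProd_le (v : Finset (Fin s)) (p u : Fin s → ℝ) : |ltIndProd v p u| ≤ 1 := by
  rw [ltIndProd, Finset.abs_prod]
  exact Finset.prod_le_one (fun i _ => abs_nonneg _) fun i _ => abs_ltInd_le _ _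

/-- The point with the coordinates of `u` in `v`, `1` in the other coordinates from the `m`-th on,
and those of `p` in the remaining ones. -/
noncomputable def mixPoint (m : ℕ) (v : Finset (Fin s)) (p u : Fin s → ℝ) : Fin s → ℝ :=
  v.piecewise u fun i => if m ≤ (i : ℕ) then 1 else p i

theorem measurable_mixPoint (m : ℕ) (v : Finset (Fin s)) (p : Fin s → ℝ) :
    Measurable (mixPoint m v p) := by
  rw [measurable_pi_iff]
  intro i
  by_cases h : i ∈ v
  · simpa [mixPoint, h] using measurable_pi_apply i
  · simp [mixPoint, h]

theorem mixPoint_mem_cube (m : ℕ) (v : Finset (Fin s)) {p u : Fin s → ℝ} (hp : p ∈ cube s)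
    (hu : u ∈ cube s) : mixPoint m v p u ∈ cube s := by
  refine piecewise_mem_cube hu ?_ v
  rw [mem_cube_iff] at *
  intro i
  split_ifs
  · simp
  · exact hp i

theorem integrable_uniformCube_of_bounded {G : (Fin s → ℝ) → ℝ} (hG : Measurable G) {C : ℝ}
    (hC : ∀ u, |G u| ≤ C) : Integrable G (uniformCube s) :=
  Integrable.of_bound hG.aestronglyMeasurable C (Eventually.of_forall hC)

theorem abs_mul_le_of_abs_le_one {x y C : ℝ} (hx : |x| ≤ 1) (hy : |y| ≤ C) : |x * y| ≤ C := by
  rw [abs_mul]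
  nlinarith [abs_nonneg x, abs_nonneg y]

theorem HasBoundedMixedPartials.integrable_term (hF : HasBoundedMixedPartials F)
    (m : ℕ) (v w : Finset (Fin s)) (p : Fin s → ℝ) :
    Measurable (fun u => ltIndProd w p u * mixedExt v F (mixPoint m v p u)) ∧
    Integrable (fun u => ltIndProd w p u * mixedExt v F (mixPoint m v p u)) (uniformCube s) := by
  have hm : Measurable (fun u => ltIndProd w p u * mixedExt v F (mixPoint m v p u)) :=
    ((measurable_ltIndProd w).comp (measurable_const.prodMk measurable_id)).mul
      ((hF.measurable_mixedExt v).comp (measurable_mixPoint m v p))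
  obtain ⟨C, hC⟩ := hF.exists_bound v
  exact ⟨hm, integrable_uniformCube_of_bounded hm fun u =>
    abs_mul_le_of_abs_le_one (abs_ltIndProd_le _ _ _) (hC _)⟩

/-- Expansion of one term of the Hlawka–Zaremba formula in the next coordinate. -/
theorem HasBoundedMixedPartials.expand (hF : HasBoundedMixedPartials F) {m : ℕ} (hm : m < s)
    {v : Finset (Fin s)} (hv : ∀ i ∈ v, (⟨m, hm⟩ : Fin s) < i) {p : Fin s → ℝ}
    (hp : p ∈ cube s) :
    ∫ u, ltIndProd v p u * mixedExt v F (mixPoint (m + 1) v p u) ∂uniformCube s =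
      ∫ u, ltIndProd v p u * mixedExt v F (mixPoint m v p u) ∂uniformCube s -
      ∫ u, ltIndProd (insert ⟨m, hm⟩ v) p u *
        mixedExt (insert ⟨m, hm⟩ v) F (mixPoint m (insert ⟨m, hm⟩ v) p u) ∂uniformCube s := by
  set j : Fin s := ⟨m, hm⟩ with hjdef
  have hjv : j ∉ v := fun h => lt_irrefl _ (hv j h)
  -- `hz1` and `hz2` identify the two evaluation points in `ftc`: coordinate `j` is either frozen at
  -- 1 or becomes a new integration variable.
  have hz1 : ∀ u, Function.update (mixPoint (m + 1) v p u) j 1 = mixPoint m v p u := by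
    intro u
    ext i
    rcases eq_or_ne i j with rfl | hij
    · simp [mixPoint, Finset.piecewise_eq_of_notMem _ _ _ hjv, hjdef]
    · have : (i : ℕ) ≠ m := fun h => hij (Fin.ext h)
      have h2 : m + 1 ≤ (i : ℕ) ↔ m ≤ (i : ℕ) := by omega
      simp only [Function.update_of_ne hij, mixPoint, Finset.piecewise, h2]
  have hz2 : ∀ u t, mixPoint m (insert j v) p (Function.update u j t)
      = Function.update (mixPoint (m + 1) v p u) j t := by
    intro u t
    ext i
    rcases eq_or_ne i j with rfl | hij
    · simp [mixPoint]
    · have : (i : ℕ) ≠ m := fun h => hij (Fin.ext h)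
      have h2 : m + 1 ≤ (i : ℕ) ↔ m ≤ (i : ℕ) := by omega
      simp only [Function.update_of_ne hij, mixPoint, Finset.piecewise, h2, Finset.mem_insert, hij,
        false_or]
  have hzj : ∀ u, mixPoint (m + 1) v p u j = p j := by
    intro u; simp [mixPoint, Finset.piecewise_eq_of_notMem _ _ _ hjv, hjdef]
  have hI : ∀ u t, ltIndProd (insert j v) p (Function.update u j t)
      = ltIndProd v p u * ltInd (p j) t := by
    intro u t
    rw [ltIndProd, Finset.prod_insert hjv, ltIndProd, mul_comm, Function.update_self]
    congr 1
    refine Finset.prod_congr rfl fun i hi => ?_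
    rw [Function.update_of_ne fun h => hjv (by rwa [← h])]
  obtain ⟨hG, hGi⟩ := hF.integrable_term m (insert j v) (insert j v) p
  -- Resampling coordinate `j` in the term for `insert j v` exhibits the inner integral over `t`
  -- that `ftc` produces.
  rw [← integral_integral_update j hG hGi, ← integral_sub (hF.integrable_term m v v p).2]
  · refine integral_congr_ae ?_
    filter_upwards [ae_uniformCube_mem] with u hu
    simp only [hI, hz2]
    rw [hF.ftc hv (mixPoint_mem_cube _ _ hp hu), hz1, hzj, mul_sub]
    congr 1
    rw [← integral_const_mul]
    simp_rw [mul_assoc]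
  · have h := ((measurePreserving_update j).integrable_comp hG.aestronglyMeasurable).2 hGi
    exact h.integral_prod_left

/-- At `m = s` the identity is `F p = F p`. Lowering `m` expands one more coordinate by `ftc`, each
`v` splitting into `v` and `insert m v`. The descent keeps the new coordinate below all those of
`v`. -/
theorem HasBoundedMixedPartials.eq_sum_mixPoint (hF : HasBoundedMixedPartials F)
    {p : Fin s → ℝ} (hp : p ∈ cube s) {m : ℕ} (hm : m ≤ s) :
    F p = ∑ v ∈ (Finset.univ.filter fun i : Fin s => m ≤ (i : ℕ)).powerset,
      (-1) ^ v.card * ∫ u, ltIndProd v p u * mixedExt v F (mixPoint m v p u) ∂uniformCube s := by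
  induction hm using Nat.decreasingInduction with
  | self =>
    have h1 : (Finset.univ.filter fun i : Fin s => s ≤ (i : ℕ)) = ∅ := by
      ext i; simp
    have h2 : ∀ u, mixPoint s ∅ p u = p := by
      intro u; ext i; simp [mixPoint]
    rw [h1]
    simp [h2, ltIndProd, mixedExt_of_mem hp, mixedPartial_empty]
  | of_succ m hm ih =>
    set j : Fin s := ⟨m, hm⟩ with hj
    have h1 : (Finset.univ.filter fun i : Fin s => m ≤ (i : ℕ))
        = insert j (Finset.univ.filter fun i : Fin s => m + 1 ≤ (i : ℕ)) := by
      ext i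
      simp only [Finset.mem_filter, Finset.mem_univ, true_and, Finset.mem_insert, hj, Fin.ext_iff]
      omega
    have h2 : j ∉ Finset.univ.filter fun i : Fin s => m + 1 ≤ (i : ℕ) := by simp [hj]
    rw [h1, Finset.sum_powerset_insert h2, ih, ← Finset.sum_add_distrib]
    refine Finset.sum_congr rfl fun v hv => ?_
    have hv' : ∀ i ∈ v, j < i := by
      intro i hi
      have := Finset.mem_powerset.1 hv hi
      simp only [Finset.mem_filter, Finset.mem_univ, true_and] at this
      exact Fin.lt_def.2 this
    rw [hF.expand hm hv' hp, Finset.card_insert_of_notMem fun h => lt_irrefl _ (hv' j h)]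
    ring

/-- The formula of Hlawka and Zaremba. -/
theorem HasBoundedMixedPartials.eq_sum (hF : HasBoundedMixedPartials F)
    {p : Fin s → ℝ} (hp : p ∈ cube s) :
    F p = ∑ v : Finset (Fin s), (-1) ^ v.card *
      ∫ u, ltIndProd v p u * mixedExt v F (v.piecewise u 1) ∂uniformCube s := by
  have h := hF.eq_sum_mixPoint hp (Nat.zero_le s)
  have h1 : ∀ v u, mixPoint 0 v p u = v.piecewise u 1 := by
    intro v u; ext i; simp [mixPoint, Finset.piecewise]
  simpa [h1] using h

/-! ### Averages of box indicators and the star discrepancy. -/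

theorem integral_ltInd {x : ℝ} (hx : x ∈ Set.Icc (0 : ℝ) 1) :
    ∫ p in Set.Icc 0 1, ltInd p x = x := by
  have h : ∀ p, ltInd p x = (Set.Iio x).indicator 1 p := by
    intro p; by_cases hp : p < x <;> simp [ltInd, hp]
  simp_rw [h]
  rw [integral_indicator_one measurableSet_Iio, measureReal_restrict_apply measurableSet_Iio]
  have : Set.Iio x ∩ Set.Icc 0 1 = Set.Ico 0 x := by
    ext p
    simp only [Set.mem_inter_iff, Set.mem_Iio, Set.mem_Icc, Set.mem_Ico]
    exact ⟨fun h => ⟨h.2.1, h.1⟩, fun h => ⟨h.2, h.1, h.2.le.trans hx.2⟩⟩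
  rw [this]
  simp [hx.1]

theorem integral_ltIndProd (v : Finset (Fin s)) {u : Fin s → ℝ} (hu : u ∈ cube s) :
    ∫ p, ltIndProd v p u ∂uniformCube s = ∏ i ∈ v, u i := by
  have h : ∀ p, ltIndProd v p u = ∏ i, (fun (i : Fin s) (x : ℝ) =>
      if i ∈ v then ltInd x (u i) else 1) i (p i) := by
    intro p; simp [ltIndProd, Finset.prod_ite_mem]
  rw [integral_congr_ae (Eventually.of_forall h)]
  rw [uniformCube_eq_pi]
  refine (integral_fintype_prod_eq_prod (𝕜 := ℝ) (fun (i : Fin s) (x : ℝ) =>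
      if i ∈ v then ltInd x (u i) else 1)).trans ?_
  rw [← Finset.prod_subset (Finset.subset_univ v)]
  · refine Finset.prod_congr rfl fun i hi => ?_
    simp [hi, integral_ltInd (mem_cube_iff.1 hu i)]
  · intro i _ hi
    simp [hi]

theorem measurable_piecewise_one (v : Finset (Fin s)) :
    Measurable fun u : Fin s → ℝ => v.piecewise u (1 : Fin s → ℝ) := by
  rw [measurable_pi_iff]
  intro i
  by_cases h : i ∈ v
  · simpa [h] using measurable_pi_apply i
  · simp [h]

/-- The integrated form of the formula of Hlawka and Zaremba. -/
theorem HasBoundedMixedPartials.integral_eq_sum (hF : HasBoundedMixedPartials F) :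
    ∫ p, F p ∂uniformCube s = ∑ v : Finset (Fin s), (-1) ^ v.card *
      ∫ u, (∏ i ∈ v, u i) * mixedExt v F (v.piecewise u 1) ∂uniformCube s := by
  have hmeas : ∀ v, Measurable (fun q : (Fin s → ℝ) × (Fin s → ℝ) =>
      ltIndProd v q.1 q.2 * mixedExt v F (v.piecewise q.2 1)) := fun v =>
    (measurable_ltIndProd v).mul
      ((hF.measurable_mixedExt v).comp ((measurable_piecewise_one v).comp measurable_snd))
  have hint : ∀ v, Integrable (fun q : (Fin s → ℝ) × (Fin s → ℝ) =>
      ltIndProd v q.1 q.2 * mixedExt v F (v.piecewise q.2 1))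
      ((uniformCube s).prod (uniformCube s)) := by
    intro v
    obtain ⟨C, hC⟩ := hF.exists_bound v
    exact Integrable.of_bound (hmeas v).aestronglyMeasurable C (Eventually.of_forall fun q =>
      abs_mul_le_of_abs_le_one (abs_ltIndProd_le _ _ _) (hC _))
  have h1 : ∫ p, F p ∂uniformCube s = ∫ p, ∑ v : Finset (Fin s), (-1) ^ v.card *
      ∫ u, ltIndProd v p u * mixedExt v F (v.piecewise u 1) ∂uniformCube s ∂uniformCube s := by
    refine integral_congr_ae ?_
    filter_upwards [ae_uniformCube_mem] with p hp using hF.eq_sum hp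
  rw [h1, integral_finsetSum _ fun v _ => (hint v).integral_prod_left.const_mul _]
  refine Finset.sum_congr rfl fun v _ => ?_
  rw [integral_const_mul]
  congr 1
  rw [integral_integral_swap (hint v)]
  refine integral_congr_ae ?_
  filter_upwards [ae_uniformCube_mem] with u hu
  rw [integral_mul_const, integral_ltIndProd v hu]

/-- An unbounded real supremum would be 0 by default; this bound is what allows `le_ciSup`. -/
theorem bddAbove_starDiscrepancy {n : ℕ} (p : Fin n → Fin s → ℝ) :
    BddAbove (Set.range fun u : cube s => |∏ j, (u : Fin s → ℝ) j -
    (({i : Fin n | ∀ j, p i j ∈ Set.Ico 0 ((u : Fin s → ℝ) j)}.ncard : ℕ) : ℝ) / n|) := by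
  refine ⟨1 + 1, ?_⟩
  rintro _ ⟨u, rfl⟩
  refine (abs_sub _ _).trans (add_le_add ?_ ?_)
  · rw [Finset.abs_prod]
    refine Finset.prod_le_one (fun i _ => abs_nonneg _) fun i _ => ?_
    have := mem_cube_iff.1 u.2 i
    rw [abs_of_nonneg this.1]; exact this.2
  · rw [abs_of_nonneg (by positivity)]
    refine div_le_one_of_le₀ ?_ (Nat.cast_nonneg n)
    have := Set.ncard_le_card {i : Fin n | ∀ j, p i j ∈ Set.Ico 0 ((u : Fin s → ℝ) j)}
    rw [Nat.card_fin] at this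
    exact_mod_cast this

theorem starDiscrepancy_nonneg {n : ℕ} (p : Fin n → Fin s → ℝ) : 0 ≤ starDiscrepancy p :=
  Real.iSup_nonneg fun _ => abs_nonneg _

/-- The discrepancy is tested on the box whose corner is `u` on `v` and 1 elsewhere. Since the
points have coordinates in `[0,1)`, the sides of length 1 impose no condition on them. -/
theorem abs_mean_ltIndProd_sub_le {n : ℕ} {p : Fin n → Fin s → ℝ}
    (hp : ∀ i j, p i j ∈ Set.Ico (0 : ℝ) 1) (v : Finset (Fin s)) {u : Fin s → ℝ}
    (hu : u ∈ cube s) :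
    |(1 / n : ℝ) * ∑ i, ltIndProd v (p i) u - ∏ i ∈ v, u i| ≤ starDiscrepancy p := by
  have hmem := piecewise_mem_cube hu one_mem_cube v
  have h := le_ciSup (bddAbove_starDiscrepancy p) ⟨_, hmem⟩
  refine le_of_eq_of_le ?_ h
  rw [abs_sub_comm]
  congr 2
  · rw [← Finset.prod_subset (Finset.subset_univ v)]
    · exact Finset.prod_congr rfl fun i hi => by simp [hi]
    · intro i _ hi; simp [hi]
  · rw [one_div, inv_mul_eq_div]
    congr 1
    have h1 : ∀ i, ltIndProd v (p i) u =
        if ∀ j, p i j ∈ Set.Ico 0 (v.piecewise u (1 : Fin s → ℝ) j) then 1 else 0 := by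
      intro i
      have h2 : (∀ j, p i j ∈ Set.Ico 0 (v.piecewise u (1 : Fin s → ℝ) j)) ↔
          ∀ j ∈ v, p i j < u j := by
        constructor
        · intro h j hj; simpa [hj] using (h j).2
        · intro h j
          by_cases hj : j ∈ v
          · simpa [hj] using ⟨(hp i j).1, h j hj⟩
          · simpa [hj] using hp i j
      simp only [h2, ltIndProd, ltInd]
      rw [Finset.prod_ite_zero]
      simp
    simp_rw [h1]
    classical
    rw [Finset.sum_ite]
    simp only [Finset.sum_const, nsmul_eq_mul, mul_one, mul_zero, add_zero]
    rw [Set.ncard_eq_toFinset_card', Set.toFinset_ofPred]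

/-- The Koksma–Hlawka inequality, with the variation in the sense of Hardy and Krause expressed
by the mixed partial derivatives. -/
theorem HasBoundedMixedPartials.koksma_hlawka (hF : HasBoundedMixedPartials F) {n : ℕ}
    (hn : 1 ≤ n) {p : Fin n → Fin s → ℝ} (hp : ∀ i j, p i j ∈ Set.Ico (0 : ℝ) 1) :
    |(1 / n : ℝ) * ∑ i, F (p i) - ∫ u, F u ∂uniformCube s| ≤ starDiscrepancy p *
      ∑ v ∈ (Finset.univ : Finset (Finset (Fin s))).erase ∅,
        ∫ u, |mixedExt v F (v.piecewise u 1)| ∂uniformCube s := by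
  have hpc : ∀ i, p i ∈ cube s := fun i =>
    mem_cube_iff.2 fun j => ⟨(hp i j).1, (hp i j).2.le⟩
  have hD : ∀ v, Measurable fun u : Fin s → ℝ => mixedExt v F (v.piecewise u 1) := fun v =>
    (hF.measurable_mixedExt v).comp (measurable_piecewise_one v)
  have hDi : ∀ v, Integrable (fun u : Fin s → ℝ => mixedExt v F (v.piecewise u 1))
      (uniformCube s) := fun v => by
    obtain ⟨C, hC⟩ := hF.exists_bound v
    exact integrable_uniformCube_of_bounded (hD v) fun u => hC _
  have hI1 : ∀ v (i : Fin n), Integrable (fun u : Fin s → ℝ =>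
      ltIndProd v (p i) u * mixedExt v F (v.piecewise u 1)) (uniformCube s) := by
    intro v i
    refine (hDi v).bdd_mul (c := 1) ?_ (Eventually.of_forall fun u => abs_ltIndProd_le _ _ _)
    exact ((measurable_ltIndProd v).comp
      (measurable_const.prodMk measurable_id)).aestronglyMeasurable
  have hI2 : ∀ v : Finset (Fin s), Integrable (fun u : Fin s → ℝ =>
      (∏ i ∈ v, u i) * mixedExt v F (v.piecewise u 1)) (uniformCube s) := by
    intro v
    refine (hDi v).bdd_mul (c := 1) ?_ ?_
    · exact (Finset.measurable_fun_prod v fun i _ => measurable_pi_apply i).aestronglyMeasurable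
    · filter_upwards [ae_uniformCube_mem] with u hu
      rw [Real.norm_eq_abs, Finset.abs_prod]
      refine Finset.prod_le_one (fun i _ => abs_nonneg _) fun i _ => ?_
      have := mem_cube_iff.1 hu i
      rw [abs_of_nonneg this.1]; exact this.2
  -- Subtracting the integrated formula from the averaged pointwise one leaves, for each `v`, a
  -- local discrepancy integrated against `∂_v F`.
  have key : (1 / n : ℝ) * ∑ i, F (p i) - ∫ u, F u ∂uniformCube s =
      ∑ v : Finset (Fin s), (-1) ^ v.card * ∫ u, ((1 / n : ℝ) * ∑ i, ltIndProd v (p i) u -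
        ∏ i ∈ v, u i) * mixedExt v F (v.piecewise u 1) ∂uniformCube s := by
    rw [hF.integral_eq_sum, Finset.sum_congr rfl fun i _ => hF.eq_sum (hpc i), Finset.sum_comm,
      Finset.mul_sum, ← Finset.sum_sub_distrib]
    refine Finset.sum_congr rfl fun v _ => ?_
    simp_rw [sub_mul]
    rw [integral_sub ?_ (hI2 v), mul_sub, ← Finset.mul_sum]
    · congr 1
      simp_rw [mul_assoc, Finset.sum_mul]
      rw [integral_const_mul, integral_finsetSum _ fun i _ => hI1 v i]
      ring
    · simp_rw [mul_assoc, Finset.sum_mul]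
      exact (integrable_finsetSum _ fun i _ => hI1 v i).const_mul _
  rw [key]
  refine (Finset.abs_sum_le_sum_abs _ _).trans ?_
  rw [← Finset.add_sum_erase _ _ (Finset.mem_univ ∅)]
  have h0 : (n : ℝ) ≠ 0 := by positivity
  -- The term `v = ∅` vanishes because constants are integrated exactly.
  have hempty : ∀ u : Fin s → ℝ, (1 / n : ℝ) * ∑ i : Fin n, ltIndProd ∅ (p i) u -
        ∏ i ∈ (∅ : Finset (Fin s)), u i = 0 := by
    intro u; simp [ltIndProd, h0]
  simp only [hempty, zero_mul, integral_zero, mul_zero, abs_zero, zero_add]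
  rw [Finset.mul_sum]
  refine Finset.sum_le_sum fun v _ => ?_
  rw [abs_mul, abs_pow, abs_neg, abs_one, one_pow, one_mul, ← integral_const_mul]
  refine (abs_integral_le_integral_abs).trans (integral_mono_of_nonneg
    (Eventually.of_forall fun _ => abs_nonneg _) ((hDi v).abs.const_mul _) ?_)
  filter_upwards [ae_uniformCube_mem] with u hu
  rw [abs_mul]
  exact mul_le_mul_of_nonneg_right (abs_mean_ltIndProd_sub_le hp v hu) (abs_nonneg _)

end KoksmaHlawka

/-! ### Mixed partial derivatives of a kernel composed with a regular map -/

section MixedPartials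

variable {s : ℕ} {g : (Fin s → ℝ) → ℝ}

/-- Polynomials in the mixed partial derivatives `g_w`, `w ⊆ v`. -/
inductive PartialPoly (g : (Fin s → ℝ) → ℝ) (v : Finset (Fin s)) : ((Fin s → ℝ) → ℝ) → Prop
  | const (c : ℝ) : PartialPoly g v fun _ => c
  | gen (w : Finset (Fin s)) (hw : w ⊆ v) : PartialPoly g v (mixedPartial w g)
  | add {φ ψ : (Fin s → ℝ) → ℝ} : PartialPoly g v φ → PartialPoly g v ψ →
      PartialPoly g v fun u => φ u + ψ u
  | mul {φ ψ : (Fin s → ℝ) → ℝ} : PartialPoly g v φ → PartialPoly g v ψ →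
      PartialPoly g v fun u => φ u * ψ u

theorem PartialPoly.mono {v v' : Finset (Fin s)} (hv : v ⊆ v') {φ : (Fin s → ℝ) → ℝ}
    (h : PartialPoly g v φ) : PartialPoly g v' φ := by
  induction h with
  | const c => exact .const c
  | gen w hw => exact .gen w (hw.trans hv)
  | add _ _ h1 h2 => exact .add h1 h2
  | mul _ _ h1 h2 => exact .mul h1 h2

theorem PartialPoly.bounded (hg : IsRegularMap g) {v : Finset (Fin s)} {φ : (Fin s → ℝ) → ℝ}
    (h : PartialPoly g v φ) : ∃ C, 0 ≤ C ∧ ∀ u ∈ cube s, |φ u| ≤ C := by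
  induction h with
  | const c => exact ⟨|c|, abs_nonneg c, fun u _ => le_rfl⟩
  | gen w hw =>
    obtain ⟨C, hC⟩ := hg.bounded w
    exact ⟨C, (abs_nonneg _).trans (hC 1 one_mem_cube), hC⟩
  | add _ _ h1 h2 =>
    obtain ⟨C, hC0, hC⟩ := h1
    obtain ⟨D, hD0, hD⟩ := h2
    exact ⟨C + D, by positivity, fun u hu => (abs_add_le _ _).trans (add_le_add (hC u hu) (hD u hu))⟩
  | mul _ _ h1 h2 =>
    obtain ⟨C, hC0, hC⟩ := h1
    obtain ⟨D, hD0, hD⟩ := h2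
    refine ⟨C * D, by positivity, fun u hu => ?_⟩
    rw [abs_mul]
    exact mul_le_mul (hC u hu) (hD u hu) (abs_nonneg _) hC0

theorem IsRegularMap.hasDerivWithinAt_mixedPartial (hg : IsRegularMap g) {w : Finset (Fin s)}
    {j : Fin s} (hj : ∀ i ∈ w, j < i) {u : Fin s → ℝ} (hu : u ∈ cube s) :
    HasDerivWithinAt (coordLine (mixedPartial w g) u j) (mixedPartial (insert j w) g u)
      (Set.Icc 0 1) (u j) := by
  have h := hasDerivWithinAt_coordLine (hg.hasPartial w j hj) hu (mem_cube_iff.1 hu j)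
  rwa [Function.update_eq_self, ← mixedPartial_insert g hj] at h

/-- By the Leibniz rule only generators matter, and `∂_j` sends `g_w` to `g_{insert j w}` because
`j` lies below `w`. -/
theorem PartialPoly.exists_deriv (hg : IsRegularMap g) {v : Finset (Fin s)}
    {φ : (Fin s → ℝ) → ℝ} (h : PartialPoly g v φ) {j : Fin s} (hj : ∀ i ∈ v, j < i) :
    ∃ ψ, PartialPoly g (insert j v) ψ ∧
      ∀ u ∈ cube s, HasDerivWithinAt (coordLine φ u j) (ψ u) (Set.Icc 0 1) (u j) := by
  induction h with
  | const c => exact ⟨fun _ => 0, .const 0, fun u _ => hasDerivWithinAt_const _ _ _⟩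
  | gen w hw =>
    exact ⟨_, .gen (insert j w) (Finset.insert_subset_insert j hw), fun u hu =>
      hg.hasDerivWithinAt_mixedPartial (fun i hi => hj i (hw hi)) hu⟩
  | add _ _ h1 h2 =>
    obtain ⟨ψ, hψ, hd⟩ := h1
    obtain ⟨ψ', hψ', hd'⟩ := h2
    exact ⟨_, .add hψ hψ', fun u hu => (hd u hu).add (hd' u hu)⟩
  | @mul φ φ' hφ hφ' h1 h2 =>
    obtain ⟨ψ, hψ, hd⟩ := h1
    obtain ⟨ψ', hψ', hd'⟩ := h2
    have hv : v ⊆ insert j v := Finset.subset_insert j v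
    refine ⟨_, .add (.mul hψ (hφ'.mono hv)) (.mul (hφ.mono hv) hψ'), fun u hu => ?_⟩
    have := (hd u hu).mul (hd' u hu)
    rwa [coordLine_self, coordLine_self] at this

/-- The mixed partial derivatives of `κ ((x - g) / h)` are given by a formula of Faà di Bruno type
with coefficients that do not depend on `κ`, `x` and `h`. -/
structure FaaDiBruno (g : (Fin s → ℝ) → ℝ) (v : Finset (Fin s)) (Q : ℕ → (Fin s → ℝ) → ℝ) :
    Prop where
  poly : ∀ r, PartialPoly g v (Q r)
  zero : ∀ r, v.card < r → ∀ u ∈ cube s, Q r u = 0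
  -- The leading coefficient is, up to sign, a product of first-order partials. Only the factor of
  -- the coordinate differentiated last is kept: one factor suffices to gain a power of `h`.
  top : ∀ j ∈ v, (∀ i ∈ v, j ≤ i) → ∃ C, 0 ≤ C ∧
    ∀ u ∈ cube s, |Q v.card u| ≤ C * |partialD j g u|
  formula : ∀ κ : ℝ → ℝ, ContDiff ℝ s κ → ∀ x h : ℝ, ∀ u ∈ cube s,
    mixedPartial v (fun u => κ ((x - g u) / h)) u =
      ∑ r ∈ Finset.range (v.card + 1), h⁻¹ ^ r * iteratedDeriv r κ ((x - g u) / h) * Q r u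

theorem FaaDiBruno.hasDerivWithinAt (hg : IsRegularMap g) {v : Finset (Fin s)}
    {Q : ℕ → (Fin s → ℝ) → ℝ} (hQ : FaaDiBruno g v Q) {j : Fin s} (hj : ∀ i ∈ v, j < i)
    {ψ : ℕ → (Fin s → ℝ) → ℝ}
    (hψ : ∀ r, ∀ u ∈ cube s, HasDerivWithinAt (coordLine (Q r) u j) (ψ r u) (Set.Icc 0 1) (u j))
    {κ : ℝ → ℝ} (hκ : ContDiff ℝ s κ) (x h : ℝ) {u : Fin s → ℝ} (hu : u ∈ cube s) :
    HasDerivWithinAt (coordLine (mixedPartial v fun u => κ ((x - g u) / h)) u j)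
      (∑ r ∈ Finset.range (v.card + 1), (h⁻¹ ^ r * (iteratedDeriv (r + 1) κ ((x - g u) / h) *
        (-partialD j g u / h)) * Q r u +
        h⁻¹ ^ r * iteratedDeriv r κ ((x - g u) / h) * ψ r u)) (Set.Icc 0 1) (u j) := by
  -- Leaves room for one more derivative of `κ`, which is only `s` times differentiable.
  have hcard : v.card < s := by
    have h1 : j ∉ v := fun h => lt_irrefl _ (hj j h)
    have h2 := (insert j v).card_le_univ
    rw [Finset.card_insert_of_notMem h1, Fintype.card_fin] at h2
    exact h2
  have hgd : HasDerivWithinAt (coordLine g u j) (partialD j g u) (Set.Icc 0 1) (u j) := by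
    have := hg.hasDerivWithinAt_mixedPartial (w := ∅) (j := j) (by simp) hu
    rwa [mixedPartial_insert g (by simp), mixedPartial_empty] at this
  have hy : HasDerivWithinAt (fun t => (x - coordLine g u j t) / h) (-partialD j g u / h)
      (Set.Icc 0 1) (u j) := by
    simpa using (hgd.const_sub x).div_const h
  have hk : ∀ r ∈ Finset.range (v.card + 1), HasDerivWithinAt
      (fun t => iteratedDeriv r κ ((x - coordLine g u j t) / h))
      (iteratedDeriv (r + 1) κ ((x - g u) / h) * (-partialD j g u / h)) (Set.Icc 0 1) (u j) := by
    intro r hr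
    have hrs : r < s := lt_of_le_of_lt (Finset.mem_range_succ_iff.1 hr) hcard
    have hd := (hκ.differentiable_iteratedDeriv r (by exact_mod_cast hrs)
      ((x - coordLine g u j (u j)) / h)).hasDerivAt
    rw [← iteratedDeriv_succ] at hd
    have := hd.comp_hasDerivWithinAt (u j) hy
    rwa [coordLine_self] at this
  have hsum := HasDerivWithinAt.fun_sum (u := Finset.range (v.card + 1)) fun r hr =>
    ((hk r hr).const_mul (h⁻¹ ^ r)).mul (hψ r u hu)
  simp only [coordLine_self] at hsum
  refine hsum.congr (fun t ht => ?_) ?_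
  · simp only [Pi.mul_apply]
    exact hQ.formula κ hκ x h _ (update_mem_cube hu j ht)
  · rw [coordLine_self]
    simp only [Pi.mul_apply, coordLine_self]
    exact hQ.formula κ hκ x h _ hu

/-- Applying `∂_j` to the formula for `v` gives the recurrence `Q'_r = -∂_j g · Q_{r-1} + ∂_j Q_r`,
with no term in `Q_{r-1}` when `r = 0`. -/
theorem exists_faaDiBruno (hg : IsRegularMap g) (v : Finset (Fin s)) :
    ∃ Q, FaaDiBruno g v Q := by
  induction v using finset_induction_min with
  | h0 =>
    refine ⟨fun r _ => if r = 0 then 1 else 0, fun r => .const _, ?_, by simp, ?_⟩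
    · intro r hr u _
      rw [if_neg (by simpa using hr.ne')]
    · intro κ _ x h u _
      simp [mixedPartial_empty]
  | h1 v j hj ih =>
    obtain ⟨Q, hQ⟩ := ih
    choose ψ hψ hd using fun r => (hQ.poly r).exists_deriv hg hj
    have hjv : j ∉ v := fun h => lt_irrefl _ (hj j h)
    have hcard := Finset.card_insert_of_notMem hjv
    -- Beyond the top index `Q r` is zero along whole lines in the cube, so its derivative vanishes
    -- too. Hence the new top coefficient is exactly `-∂_j g` times the old one.
    have hψ0 : ∀ r, v.card < r → ∀ u ∈ cube s, ψ r u = 0 := by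
      intro r hr u hu
      rw [← partialD_eq_of_hasDerivWithinAt hu (hd r u hu)]
      refine partialD_eq_of_hasDerivWithinAt hu ?_
      refine (hasDerivWithinAt_const (u j) (Set.Icc 0 1) (0 : ℝ)).congr (fun t ht => ?_) ?_
      · exact hQ.zero r hr _ (update_mem_cube hu j ht)
      · rw [coordLine_self]; exact hQ.zero r hr _ hu
    have hgj := mixedPartial_singleton g j
    refine ⟨fun r => match r with
      | 0 => ψ 0
      | r + 1 => fun u => -1 * partialD j g u * Q r u + ψ (r + 1) u, ?_, ?_, ?_, ?_⟩
    · intro r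
      match r with
      | 0 => exact hψ 0
      | r + 1 =>
        refine .add (.mul (.mul (.const (-1)) ?_) ((hQ.poly r).mono (Finset.subset_insert j v)))
          (hψ (r + 1))
        rw [← hgj]
        exact .gen {j} (by simp)
    · intro r hr u hu
      rw [hcard] at hr
      match r with
      | r + 1 =>
        simp only
        rw [hQ.zero r (by omega) u hu, hψ0 (r + 1) (by omega) u hu]
        simp
    · intro i hi hmin
      have hij : i = j := by
        rcases Finset.mem_insert.1 hi with h | h
        · exact h
        · exact absurd (hmin j (Finset.mem_insert_self j v)) (not_le.2 (hj i h))
      subst hij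
      obtain ⟨C, hC0, hC⟩ := (hQ.poly v.card).bounded hg
      refine ⟨C, hC0, fun u hu => ?_⟩
      rw [hcard]
      simp only
      rw [hψ0 _ (Nat.lt_succ_self _) u hu, add_zero, abs_mul, abs_mul, abs_neg, abs_one, one_mul,
        mul_comm]
      exact mul_le_mul_of_nonneg_right (hC u hu) (abs_nonneg _)
    · intro κ hκ x h u hu
      rw [mixedPartial_insert _ hj,
        partialD_eq_of_hasDerivWithinAt hu (hQ.hasDerivWithinAt hg hj hd hκ x h hu), hcard,
        Finset.sum_add_distrib, Finset.sum_range_succ' _ (v.card + 1)]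
      -- The sum with `ψ` is extended by its zero term so that it has the range of the shifted sum.
      have h2 := Finset.sum_range_succ
        (fun r => h⁻¹ ^ r * iteratedDeriv r κ ((x - g u) / h) * ψ r u) (v.card + 1)
      rw [hψ0 _ (Nat.lt_succ_self _) u hu, mul_zero, add_zero] at h2
      rw [← h2, Finset.sum_range_succ' _ (v.card + 1), ← add_assoc, ← Finset.sum_add_distrib]
      congr 1
      refine Finset.sum_congr rfl fun r _ => ?_
      rw [pow_succ]
      ring

/-! ### Continuity and measurability of a regular map. -/

theorem IsRegularMap.exists_lipschitz (hg : IsRegularMap g) (j : Fin s) :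
    ∃ C, ∀ u ∈ cube s, ∀ t ∈ Set.Icc (0 : ℝ) 1,
      |g (Function.update u j t) - g u| ≤ C * |t - u j| := by
  obtain ⟨C, hC⟩ := hg.bounded {j}
  have hgj := mixedPartial_singleton g j
  refine ⟨C, fun u hu t ht => ?_⟩
  have h := Convex.norm_image_sub_le_of_norm_hasDerivWithin_le (C := C)
    (fun r hr => hasDerivWithinAt_coordLine (φ := g) (j := j)
      (by simpa [mixedPartial_empty] using hg.hasPartial ∅ j (by simp)) hu hr)
    (fun r hr => by rw [← hgj]; exact hC _ (update_mem_cube hu j hr))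
    (convex_Icc 0 1) (mem_cube_iff.1 hu j) ht
  rwa [coordLine_self] at h

/-- One passes from `u` to `u'` by changing one coordinate at a time and adds up the coordinatewise
Lipschitz bounds. -/
theorem IsRegularMap.continuousOn (hg : IsRegularMap g) : ContinuousOn g (cube s) := by
  choose C hC using hg.exists_lipschitz
  have key : ∀ u ∈ cube s, ∀ u' ∈ cube s, ∀ S : Finset (Fin s),
      |g (S.piecewise u' u) - g u| ≤ ∑ j ∈ S, C j * |u' j - u j| := by
    intro u hu u' hu' S
    induction S using Finset.induction_on with
    | empty => simp
    | insert j S hj ih =>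
      rw [Finset.piecewise_insert, Finset.sum_insert hj]
      have h1 := hC j _ (piecewise_mem_cube hu' hu S) _ (mem_cube_iff.1 hu' j)
      rw [Finset.piecewise_eq_of_notMem _ _ _ hj] at h1
      exact (abs_sub_le _ _ _).trans (add_le_add h1 ih)
  intro u hu
  rw [ContinuousWithinAt, tendsto_iff_norm_sub_tendsto_zero]
  have hlim : Tendsto (fun u' : Fin s → ℝ => ∑ j, C j * |u' j - u j|) (𝓝[cube s] u) (𝓝 0) := by
    have hc : Continuous fun u' : Fin s → ℝ => ∑ j, C j * |u' j - u j| := by fun_prop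
    have := (hc.tendsto u).mono_left (nhdsWithin_le_nhds (s := cube s))
    simpa using this
  refine squeeze_zero' (Eventually.of_forall fun _ => norm_nonneg _) ?_ hlim
  filter_upwards [self_mem_nhdsWithin] with u' hu'
  simpa using key u hu u' hu' Finset.univ

theorem measurable_indicator_comp {α : Type*} [MeasurableSpace α] {S : Set α}
    (hS : MeasurableSet S) {φ : α → ℝ} (hφ : Measurable (S.indicator φ)) {κ : ℝ → ℝ}
    (hκ : Measurable κ) : Measurable (S.indicator fun u => κ (φ u)) := by
  have : (S.indicator fun u => κ (φ u)) = S.indicator fun u => κ (S.indicator φ u) := by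
    ext u; by_cases hu : u ∈ S <;> simp [hu]
  rw [this]
  exact (hκ.comp hφ).indicator hS

theorem IsRegularMap.measurable_indicator (hg : IsRegularMap g) :
    Measurable ((cube s).indicator g) := by
  classical
  rw [← Set.piecewise_eq_indicator]
  exact hg.continuousOn.measurable_piecewise continuous_zero.continuousOn measurableSet_cube

/-- This makes `koksma_hlawka` applicable. The bounds found here are too large in `h` for the rate;
the sharp ones hold only for the integrals. -/
theorem IsRegularMap.hasBoundedMixedPartials (hg : IsRegularMap g) {κ : ℝ → ℝ}
    (hκ : IsSmoothKernel s κ) (x h : ℝ) :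
    HasBoundedMixedPartials fun u => κ ((x - g u) / h) where
  measurable := measurable_indicator_comp measurableSet_cube hg.measurable_indicator
    (κ := fun y => κ ((x - y) / h)) (hκ.contDiff.continuous.measurable.comp (by fun_prop))
  hasPartial w j hj u hu := by
    obtain ⟨Q, hQ⟩ := exists_faaDiBruno hg w
    choose ψ hψ hd using fun r => (hQ.poly r).exists_deriv hg hj
    exact (hQ.hasDerivWithinAt hg hj hd hκ.contDiff x h hu).differentiableWithinAt
  bounded v := by
    obtain ⟨Q, hQ⟩ := exists_faaDiBruno hg v
    choose C hC0 hC using fun r => (hQ.poly r).bounded hg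
    have hv : v.card ≤ s := by simpa using v.card_le_univ
    choose! B hB using hκ.bounded
    refine ⟨∑ r ∈ Finset.range (v.card + 1), |h⁻¹ ^ r| * B r * C r, fun u hu => ?_⟩
    rw [hQ.formula κ hκ.contDiff x h u hu]
    refine (Finset.abs_sum_le_sum_abs _ _).trans (Finset.sum_le_sum fun r hr => ?_)
    have hB' := hB r ((Finset.mem_range_succ_iff.1 hr).trans hv)
    rw [abs_mul, abs_mul]
    exact mul_le_mul (mul_le_mul_of_nonneg_left (hB' _) (abs_nonneg _)) (hC r u hu)
      (abs_nonneg _) (mul_nonneg (abs_nonneg _) ((abs_nonneg _).trans (hB' 0)))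

end MixedPartials

/-! ### The variation of a kernel composed with a regular map -/

section Variation

/-- Change of variables `y = φ t`. Injectivity is not needed, since `φ' = 0` wherever `φ` is locally
constant; the inequality comes from enlarging the image to the whole line. -/
theorem lintegral_deriv_mul_comp_le_of_monotone_or_antitone {φ φ' : ℝ → ℝ} {a b : ℝ}
    (hd : ∀ t ∈ Set.Icc a b, HasDerivWithinAt φ (φ' t) (Set.Icc a b) t)
    (hφ : MonotoneOn φ (Set.Icc a b) ∨ AntitoneOn φ (Set.Icc a b)) (ρ : ℝ → ENNReal) :
    ∫⁻ t in Set.Icc a b, ENNReal.ofReal |φ' t| * ρ (φ t) ≤ ∫⁻ y, ρ y := by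
  rcases lt_or_ge a b with hab | hab
  · have hder : ∀ t ∈ Set.Icc a b, φ' t = derivWithin φ (Set.Icc a b) t := fun t ht =>
      ((hd t ht).derivWithin (uniqueDiffOn_Icc hab t ht)).symm
    rcases hφ with hφ | hφ
    · calc ∫⁻ t in Set.Icc a b, ENNReal.ofReal |φ' t| * ρ (φ t)
          = ∫⁻ t in Set.Icc a b, ENNReal.ofReal (φ' t) * ρ (φ t) := by
            refine setLIntegral_congr_fun measurableSet_Icc fun t ht => ?_
            rw [abs_of_nonneg (by rw [hder t ht]; exact hφ.derivWithin_nonneg)]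
        _ = ∫⁻ y in φ '' Set.Icc a b, ρ y :=
            (lintegral_image_eq_lintegral_deriv_mul_of_monotoneOn measurableSet_Icc hd hφ ρ).symm
        _ ≤ _ := setLIntegral_le_lintegral _ _
    · calc ∫⁻ t in Set.Icc a b, ENNReal.ofReal |φ' t| * ρ (φ t)
          = ∫⁻ t in Set.Icc a b, ENNReal.ofReal (-φ' t) * ρ (φ t) := by
            refine setLIntegral_congr_fun measurableSet_Icc fun t ht => ?_
            rw [abs_of_nonpos (by rw [hder t ht]; exact hφ.derivWithin_nonpos)]
        _ = ∫⁻ y in φ '' Set.Icc a b, ρ y :=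
            (lintegral_image_eq_lintegral_deriv_mul_of_antitoneOn measurableSet_Icc hd hφ ρ).symm
        _ ≤ _ := setLIntegral_le_lintegral _ _
  -- Degenerate pieces occur, as break points may coincide.
  · have : volume (Set.Icc a b) = 0 := by simp [hab]
    rw [setLIntegral_measure_zero _ _ this]
    exact zero_le

/-- Each piece contributes at most `∫ ρ`, whatever the size of `φ'`. -/
theorem PiecewiseMonotone.lintegral_deriv_mul_comp_le {φ φ' : ℝ → ℝ} {M : ℕ}
    (hφ : PiecewiseMonotone M φ)
    (hd : ∀ t ∈ Set.Icc (0 : ℝ) 1, HasDerivWithinAt φ (φ' t) (Set.Icc 0 1) t)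
    (ρ : ℝ → ENNReal) :
    ∫⁻ t in Set.Icc 0 1, ENNReal.ofReal |φ' t| * ρ (φ t) ≤ M * ∫⁻ y, ρ y := by
  obtain ⟨p, hp, hp0, hpM, hmono⟩ := hφ
  have key : ∀ m ≤ M, ∫⁻ t in Set.Icc (p 0) (p m), ENNReal.ofReal |φ' t| * ρ (φ t)
      ≤ m * ∫⁻ y, ρ y := by
    intro m
    induction m with
    | zero => intro _; simp
    | succ m ih =>
      intro hm
      have hsub : Set.Icc (p m) (p (m + 1)) ⊆ Set.Icc 0 1 :=
        Set.Icc_subset_Icc (by rw [← hp0]; exact hp (Nat.zero_le _))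
          (by rw [← hpM]; exact hp hm)
      calc ∫⁻ t in Set.Icc (p 0) (p (m + 1)), ENNReal.ofReal |φ' t| * ρ (φ t)
          ≤ ∫⁻ t in Set.Icc (p 0) (p m) ∪ Set.Icc (p m) (p (m + 1)),
              ENNReal.ofReal |φ' t| * ρ (φ t) :=
            lintegral_mono_set Set.Icc_subset_Icc_union_Icc
        _ ≤ _ := lintegral_union_le _ _ _
        _ ≤ m * (∫⁻ y, ρ y) + ∫⁻ y, ρ y := add_le_add (ih (by omega))
            (lintegral_deriv_mul_comp_le_of_monotone_or_antitone
              (fun t ht => (hd t (hsub ht)).mono hsub) (hmono m (by omega)) ρ)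
        _ = _ := by push_cast; ring
  have := key M le_rfl
  rwa [hp0, hpM] at this

variable {s : ℕ} {g : (Fin s → ℝ) → ℝ}

theorem integral_comp_sub_div_eq (κ : ℝ → ℝ) (x : ℝ) {h : ℝ} (hh : 0 < h) :
    ∫ y, κ ((x - y) / h) = h * ∫ z, κ z := by
  rw [integral_sub_left_eq_self (fun z => κ (z / h)) volume x,
    Measure.integral_comp_div κ h, abs_of_pos hh, smul_eq_mul]

theorem integrable_comp_sub_div {κ : ℝ → ℝ} (hκ : Integrable κ) (x : ℝ) {h : ℝ} (hh : 0 < h) :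
    Integrable fun y => κ ((x - y) / h) :=
  (hκ.comp_div hh.ne').comp_sub_left x

/-- The product of the kernel and a first order partial derivative has a mean of order `h` over
any line in the corresponding direction. -/
theorem IsRegularMap.integral_line_le (hg : IsRegularMap g) {j : Fin s} {M : ℕ}
    (hM : ∀ u ∈ cube s, PiecewiseMonotone M (coordLine g u j)) {κ : ℝ → ℝ}
    (hκ : Integrable κ) (x : ℝ) {h : ℝ} (hh : 0 < h) {u : Fin s → ℝ} (hu : u ∈ cube s) :
    ∫ t in Set.Icc 0 1, |partialD j g (Function.update u j t)| *
      |κ ((x - g (Function.update u j t)) / h)| ≤ M * (h * ∫ z, |κ z|) := by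
  have hnn : 0 ≤ M * (h * ∫ z, |κ z|) := by
    have : 0 ≤ ∫ z, |κ z| := integral_nonneg fun _ => abs_nonneg _
    positivity
  have hgd := fun t (ht : t ∈ Set.Icc (0 : ℝ) 1) => hasDerivWithinAt_coordLine (φ := g) (j := j)
      (by simpa [mixedPartial_empty] using hg.hasPartial ∅ j (by simp)) hu ht
  -- If the integrand is not measurable, its integral is 0 by default and the bound is trivial.
  by_cases hmeas : AEStronglyMeasurable (fun t => |partialD j g (Function.update u j t)| *
      |κ ((x - g (Function.update u j t)) / h)|) (volume.restrict (Set.Icc 0 1))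
  · rw [integral_eq_lintegral_of_nonneg_ae (Eventually.of_forall fun t => by positivity) hmeas]
    refine ENNReal.toReal_le_of_le_ofReal hnn ?_
    simp_rw [ENNReal.ofReal_mul (abs_nonneg _)]
    refine ((hM u hu).lintegral_deriv_mul_comp_le hgd
      fun y => ENNReal.ofReal |κ ((x - y) / h)|).trans ?_
    rw [← ofReal_integral_eq_lintegral_ofReal (integrable_comp_sub_div hκ x hh).abs
      (Eventually.of_forall fun _ => abs_nonneg _), integral_comp_sub_div_eq (fun z => |κ z|) x hh,
      ENNReal.ofReal_mul (Nat.cast_nonneg M), ENNReal.ofReal_natCast]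
  · rw [integral_non_aestronglyMeasurable hmeas]
    exact hnn

/-- The line bound is averaged over the other coordinates. It applies on the face because `j ∈ v` is
still free there. -/
theorem IsRegularMap.integral_piecewise_le (hg : IsRegularMap g) {j : Fin s} {M : ℕ}
    (hM : ∀ u ∈ cube s, PiecewiseMonotone M (coordLine g u j)) {κ : ℝ → ℝ}
    (hκm : Measurable κ) {B : ℝ} (hB : ∀ x, |κ x| ≤ B) (hκ : Integrable κ) (x : ℝ) {h : ℝ}
    (hh : 0 < h) {v : Finset (Fin s)} (hj : j ∈ v) :
    ∫ u, |partialD j g (v.piecewise u 1)| * |κ ((x - g (v.piecewise u 1)) / h)| ∂uniformCube s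
      ≤ M * (h * ∫ z, |κ z|) ∧
    Integrable (fun u : Fin s → ℝ => |partialD j g (v.piecewise u 1)| *
      |κ ((x - g (v.piecewise u 1)) / h)|) (uniformCube s) := by
  have hgj := mixedPartial_singleton g j
  obtain ⟨C, hC⟩ := hg.bounded {j}
  rw [hgj] at hC
  set T : (Fin s → ℝ) → ℝ := fun u => |(cube s).indicator (partialD j g) u| *
    |(cube s).indicator (fun u => κ ((x - g u) / h)) u| with hT
  have hTm : Measurable T := by
    have h1 : Measurable ((cube s).indicator (partialD j g)) :=
      measurable_indicator_partialD hg.measurable_indicator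
        (by simpa [mixedPartial_empty] using hg.hasPartial ∅ j (by simp))
    have h2 : Measurable ((cube s).indicator (fun u => κ ((x - g u) / h))) :=
      measurable_indicator_comp measurableSet_cube hg.measurable_indicator
        (κ := fun y => κ ((x - y) / h)) (hκm.comp (by fun_prop))
    exact h1.norm.mul h2.norm
  have hTe : ∀ u ∈ cube s, T u = |partialD j g u| * |κ ((x - g u) / h)| := by
    intro u hu; simp [hT, hu]
  have hTb : ∀ u, |T u| ≤ |C| * |B| := by
    intro u
    by_cases hu : u ∈ cube s
    · rw [hTe u hu, abs_mul, abs_abs, abs_abs]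
      exact mul_le_mul ((hC u hu).trans (le_abs_self C)) ((hB _).trans (le_abs_self B))
        (abs_nonneg _) (abs_nonneg _)
    · simp only [hT, Set.indicator_of_notMem hu, abs_zero, mul_zero]
      positivity
  set G : (Fin s → ℝ) → ℝ := fun u => T (v.piecewise u 1) with hG
  have hGm : Measurable G := hTm.comp (measurable_piecewise_one v)
  have hGi : Integrable G (uniformCube s) := integrable_uniformCube_of_bounded hGm fun u => hTb _
  have hcongr : (fun u : Fin s → ℝ => |partialD j g (v.piecewise u 1)| *
      |κ ((x - g (v.piecewise u 1)) / h)|) =ᵐ[uniformCube s] G := by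
    filter_upwards [ae_uniformCube_mem] with u hu
    rw [hG]
    simp only
    rw [hTe _ (piecewise_mem_cube hu one_mem_cube v)]
  refine ⟨?_, hGi.congr hcongr.symm⟩
  rw [integral_congr_ae hcongr, ← integral_integral_update j hGm hGi]
  have hmono : ∫ u, (∫ t in Set.Icc 0 1, G (Function.update u j t)) ∂uniformCube s ≤
      ∫ _, (M * (h * ∫ z, |κ z|)) ∂uniformCube s := by
    refine integral_mono_ae ?_ (integrable_const _) ?_
    · have h := ((measurePreserving_update j).integrable_comp hGm.aestronglyMeasurable).2 hGi
      exact h.integral_prod_left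
    · filter_upwards [ae_uniformCube_mem] with u hu
      refine le_trans (le_of_eq ?_) (hg.integral_line_le hM hκ x hh
        (piecewise_mem_cube hu one_mem_cube v))
      refine setIntegral_congr_fun measurableSet_Icc fun t ht => ?_
      simp only [hG]
      have hup : v.piecewise (Function.update u j t) (1 : Fin s → ℝ)
          = Function.update (v.piecewise u 1) j t := by
        ext i
        rcases eq_or_ne i j with rfl | hij
        · simp [hj]
        · by_cases hi : i ∈ v <;> simp [hi, hij]
      rw [hup]
      exact hTe _ (update_mem_cube (piecewise_mem_cube hu one_mem_cube v) j ht)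
  simpa using hmono

/-- The mixed partial derivatives of `k ((x - g) / h)` have mean `O(h^{1-|v|})` on the faces of the
cube, uniformly in `x`. -/
theorem IsRegularMap.exists_integral_mixedExt_le (hg : IsRegularMap g) {k : ℝ → ℝ}
    (hk : IsSmoothKernel s k) {v : Finset (Fin s)} (hv : v.Nonempty) :
    ∃ C, 0 ≤ C ∧ ∀ x, ∀ h ∈ Set.Ioc (0 : ℝ) 1,
      ∫ u, |mixedExt v (fun u => k ((x - g u) / h)) (v.piecewise u 1)| ∂uniformCube s
        ≤ C * (h * h⁻¹ ^ v.card) := by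
  obtain ⟨Q, hQ⟩ := exists_faaDiBruno hg v
  have hj := v.min'_mem hv
  set j := v.min' hv
  obtain ⟨M, hM⟩ := hg.piecewiseMonotone j
  obtain ⟨C, hC0, hC⟩ := hQ.top j hj fun i hi => v.min'_le i hi
  choose D hD0 hD using fun r => (hQ.poly r).bounded hg
  choose! B hB using hk.bounded
  have hvs : v.card ≤ s := by simpa using v.card_le_univ
  have hB0 : ∀ r ≤ s, 0 ≤ B r := fun r hr => (abs_nonneg _).trans (hB r hr 0)
  set κ := iteratedDeriv v.card k with hκ
  have hκm : Measurable κ :=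
    (hk.contDiff.continuous_iteratedDeriv v.card (by exact_mod_cast hvs)).measurable
  have hI : 0 ≤ ∫ z, |κ z| := integral_nonneg fun _ => abs_nonneg _
  have hS : 0 ≤ ∑ r ∈ Finset.range v.card, B r * D r := Finset.sum_nonneg fun r hr =>
    mul_nonneg (hB0 r ((Finset.mem_range.1 hr).le.trans hvs)) (hD0 r)
  -- The sum accounts for the orders `r < |v|`, bounded pointwise; the last summand for `r = |v|`,
  -- bounded through the line integral.
  refine ⟨∑ r ∈ Finset.range v.card, B r * D r + C * (M * ∫ z, |κ z|), by positivity, ?_⟩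
  rintro x h ⟨h0, h1⟩
  have hinv : 1 ≤ h⁻¹ := (one_le_inv₀ h0).2 h1
  obtain ⟨hle, hint⟩ := hg.integral_piecewise_le hM hκm (hB _ hvs) (hk.integrable _ hvs) x h0 hj
  have hpt : ∀ u ∈ cube s, |mixedPartial v (fun u => k ((x - g u) / h)) u| ≤
      (∑ r ∈ Finset.range v.card, B r * D r) * (h * h⁻¹ ^ v.card) +
        h⁻¹ ^ v.card * C * (|partialD j g u| * |κ ((x - g u) / h)|) := by
    intro u hu
    rw [hQ.formula k hk.contDiff x h u hu, Finset.sum_range_succ]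
    refine (abs_add_le _ _).trans (add_le_add ?_ ?_)
    · rw [Finset.sum_mul]
      refine (Finset.abs_sum_le_sum_abs _ _).trans (Finset.sum_le_sum fun r hr => ?_)
      have hr' := Finset.mem_range.1 hr
      rw [abs_mul, abs_mul, abs_of_nonneg (by positivity)]
      -- The right side is `h^{-(|v|-1)}`, and `r ≤ |v| - 1` with `h ≤ 1`.
      have hp : h⁻¹ ^ r ≤ h * h⁻¹ ^ v.card := by
        obtain ⟨c, hc⟩ := Nat.exists_eq_succ_of_ne_zero (Finset.card_pos.2 hv).ne'
        rw [hc, pow_succ, mul_comm (h⁻¹ ^ c), ← mul_assoc, mul_inv_cancel₀ h0.ne', one_mul]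
        exact pow_le_pow_right₀ hinv (by omega)
      have hrs : r ≤ s := hr'.le.trans hvs
      calc h⁻¹ ^ r * |iteratedDeriv r k ((x - g u) / h)| * |Q r u|
          ≤ (h * h⁻¹ ^ v.card) * B r * D r :=
            mul_le_mul (mul_le_mul hp (hB r hrs _) (abs_nonneg _) (by positivity)) (hD r u hu)
              (abs_nonneg _) (mul_nonneg (by positivity) (hB0 r hrs))
        _ = _ := by ring
    · rw [abs_mul, abs_mul, abs_of_nonneg (by positivity : 0 ≤ h⁻¹ ^ v.card)]
      calc h⁻¹ ^ v.card * |iteratedDeriv v.card k ((x - g u) / h)| * |Q v.card u|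
          ≤ h⁻¹ ^ v.card * |iteratedDeriv v.card k ((x - g u) / h)| * (C * |partialD j g u|) :=
            mul_le_mul_of_nonneg_left (hC u hu) (by positivity)
        _ = _ := by rw [hκ]; ring
  have hmono : ∫ u, |mixedExt v (fun u => k ((x - g u) / h)) (v.piecewise u 1)| ∂uniformCube s ≤
      ∫ u, ((∑ r ∈ Finset.range v.card, B r * D r) * (h * h⁻¹ ^ v.card) +
        h⁻¹ ^ v.card * C * (|partialD j g (v.piecewise u 1)| *
          |κ ((x - g (v.piecewise u 1)) / h)|)) ∂uniformCube s := by
    refine integral_mono_of_nonneg (Eventually.of_forall fun _ => abs_nonneg _)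
      ((integrable_const _).add (hint.const_mul _)) ?_
    filter_upwards [ae_uniformCube_mem] with u hu
    have hu' := piecewise_mem_cube hu one_mem_cube v
    rw [mixedExt_of_mem hu']
    exact hpt _ hu'
  refine hmono.trans ?_
  rw [integral_add (integrable_const _) (hint.const_mul _), integral_const, integral_const_mul,
    probReal_univ, one_smul, add_mul]
  refine add_le_add le_rfl ?_
  calc h⁻¹ ^ v.card * C * ∫ u, |partialD j g (v.piecewise u 1)| *
          |κ ((x - g (v.piecewise u 1)) / h)| ∂uniformCube s
      ≤ h⁻¹ ^ v.card * C * (M * (h * ∫ z, |κ z|)) :=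
        mul_le_mul_of_nonneg_left hle (by positivity)
    _ = _ := by ring

/-- The error of the quasi-Monte Carlo kernel density estimator as an approximation of its mean. -/
theorem IsRegularMap.exists_abs_kde_sub_le (hg : IsRegularMap g) {k : ℝ → ℝ}
    (hk : IsSmoothKernel s k) : ∃ C, 0 ≤ C ∧ ∀ n : ℕ, 1 ≤ n → ∀ h ∈ Set.Ioc (0 : ℝ) 1, ∀ x,
      ∀ p : Fin n → Fin s → ℝ, (∀ i j, p i j ∈ Set.Ico (0 : ℝ) 1) →
      |kde k h (fun i => g (p i)) x - 1 / h * ∫ u, k ((x - g u) / h) ∂uniformCube s|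
        ≤ C * starDiscrepancy p * h⁻¹ ^ s := by
  have hex : ∀ v : Finset (Fin s), ∃ C, 0 ≤ C ∧ (v.Nonempty → ∀ x, ∀ h ∈ Set.Ioc (0 : ℝ) 1,
      ∫ u, |mixedExt v (fun u => k ((x - g u) / h)) (v.piecewise u 1)| ∂uniformCube s
        ≤ C * (h * h⁻¹ ^ v.card)) := by
    intro v
    by_cases hv : v.Nonempty
    · obtain ⟨C, hC0, hC⟩ := hg.exists_integral_mixedExt_le hk hv
      exact ⟨C, hC0, fun _ => hC⟩
    · exact ⟨0, le_rfl, fun h => absurd h hv⟩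
  choose C hC0 hC using hex
  refine ⟨∑ v ∈ (Finset.univ : Finset (Finset (Fin s))).erase ∅, C v,
    Finset.sum_nonneg fun v _ => hC0 v, ?_⟩
  rintro n hn h ⟨h0, h1⟩ x p hp
  have hinv : 1 ≤ h⁻¹ := (one_le_inv₀ h0).2 h1
  have hKH := (hg.hasBoundedMixedPartials hk x h).koksma_hlawka hn hp
  have hrw : kde k h (fun i => g (p i)) x - 1 / h * ∫ u, k ((x - g u) / h) ∂uniformCube s =
      h⁻¹ * ((1 / n : ℝ) * ∑ i, k ((x - g (p i)) / h) -
        ∫ u, k ((x - g u) / h) ∂uniformCube s) := by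
    rw [kde, one_div, one_div, one_div, mul_inv]
    ring
  rw [hrw, abs_mul, abs_of_pos (inv_pos.2 h0)]
  -- As `h ≤ 1`, the full set of coordinates gives the worst power. The spare factor `h` then
  -- cancels the `1/h` of the estimator.
  have hsum : ∑ v ∈ (Finset.univ : Finset (Finset (Fin s))).erase ∅,
        ∫ u, |mixedExt v (fun u => k ((x - g u) / h)) (v.piecewise u 1)| ∂uniformCube s ≤
      (∑ v ∈ (Finset.univ : Finset (Finset (Fin s))).erase ∅, C v) * (h * h⁻¹ ^ s) := by
    rw [Finset.sum_mul]
    refine Finset.sum_le_sum fun v hv => ?_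
    have hv' := Finset.nonempty_iff_ne_empty.2 (Finset.ne_of_mem_erase hv)
    refine (hC v hv' x h ⟨h0, h1⟩).trans (mul_le_mul_of_nonneg_left
      (mul_le_mul_of_nonneg_left (pow_le_pow_right₀ hinv ?_) h0.le) (hC0 v))
    simpa using v.card_le_univ
  calc _ ≤ h⁻¹ * (starDiscrepancy p *
      ((∑ v ∈ (Finset.univ : Finset (Finset (Fin s))).erase ∅, C v) * (h * h⁻¹ ^ s))) :=
        mul_le_mul_of_nonneg_left (hKH.trans (mul_le_mul_of_nonneg_left hsum
          (starDiscrepancy_nonneg p))) (inv_pos.2 h0).le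
    _ = (h⁻¹ * h) * ((∑ v ∈ (Finset.univ : Finset (Finset (Fin s))).erase ∅, C v) *
          starDiscrepancy p * h⁻¹ ^ s) := by ring
    _ = _ := by rw [inv_mul_cancel₀ h0.ne', one_mul]

end Variation

/-! ### The bias of the kernel density estimator -/

section Bias

theorem FourTimesDifferentiableAt.eventually {f : ℝ → ℝ} {x : ℝ}
    (hf : FourTimesDifferentiableAt f x) :
    ∀ᶠ y in 𝓝 x, ∀ r < 3, DifferentiableAt ℝ (iteratedDeriv r f) y := by
  have := hf.1
  filter_upwards [this 0 (by norm_num), this 1 (by norm_num), this 2 (by norm_num)] with y h0 h1 h2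
  intro r hr
  interval_cases r <;> assumption

/-- A uniform first order Taylor expansion about the points of a compact interval. -/
theorem exists_taylor_bound {f : ℝ → ℝ} {a b : ℝ}
    (hf : ∀ x ∈ Set.Icc a b, FourTimesDifferentiableAt f x) :
    ∃ δ > 0, ∃ A, 0 ≤ A ∧ ∀ x ∈ Set.Icc a b, |f x| ≤ A ∧ |deriv f x| ≤ A ∧
      ∀ y, |y - x| ≤ δ → |f y - f x - deriv f x * (y - x)| ≤ A * (y - x) ^ 2 := by
  -- `V` is an open neighbourhood of `[a,b]`. A compact thickening inside it yields one radius `δ`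
  -- for all `x` and bounds on `f`, `f'` and `f''`.
  set V : Set ℝ := {x | ∀ᶠ y in 𝓝 x, ∀ r < 3, DifferentiableAt ℝ (iteratedDeriv r f) y} with hV
  have hVo : IsOpen V := isOpen_setOfPred_eventually_nhds
  obtain ⟨δ, hδ, hsub⟩ := isCompact_Icc.exists_cthickening_subset_open hVo
    fun x hx => (hf x hx).eventually
  set W := Metric.cthickening δ (Set.Icc a b) with hW
  have hWc : IsCompact W := isCompact_Icc.cthickening
  have hd : ∀ y ∈ W, ∀ r < 3, DifferentiableAt ℝ (iteratedDeriv r f) y := fun y hy =>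
    (hsub hy).self_of_nhds
  have hbd : ∀ r < 3, ∃ C, ∀ y ∈ W, |iteratedDeriv r f y| ≤ C := fun r hr =>
    hWc.exists_bound_of_continuousOn fun y hy =>
      (hd y hy r hr).continuousAt.continuousWithinAt
  obtain ⟨C0, hC0⟩ := hbd 0 (by norm_num)
  obtain ⟨C1, hC1⟩ := hbd 1 (by norm_num)
  obtain ⟨C2, hC2⟩ := hbd 2 (by norm_num)
  simp only [iteratedDeriv_zero] at hC0
  rw [iteratedDeriv_one] at hC1
  set A := max (max C0 C1) (max C2 0) with hA
  have hA0 : C0 ≤ A := (le_max_left _ _).trans (le_max_left _ _)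
  have hA1 : C1 ≤ A := (le_max_right _ _).trans (le_max_left _ _)
  have hA2 : C2 ≤ A := (le_max_left _ _).trans (le_max_right _ _)
  refine ⟨δ, hδ, A, (le_max_right _ _).trans (le_max_right _ _), fun x hx => ?_⟩
  have hxW : x ∈ W := Metric.self_subset_cthickening _ hx
  refine ⟨(hC0 x hxW).trans hA0, (hC1 x hxW).trans hA1, fun y hy => ?_⟩
  have hseg : ∀ z ∈ Set.uIcc x y, z ∈ W ∧ |z - x| ≤ |y - x| := by
    intro z hz
    have h1 : |z - x| ≤ |y - x| := Set.abs_sub_left_of_mem_uIcc hz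
    exact ⟨Metric.mem_cthickening_of_dist_le z x δ _ hx
      (by rw [Real.dist_eq]; exact h1.trans hy), h1⟩
  have hlip : ∀ z ∈ Set.uIcc x y, |deriv f z - deriv f x| ≤ A * |y - x| := by
    intro z hz
    have h := Convex.norm_image_sub_le_of_norm_hasDerivWithin_le (f := deriv f)
      (f' := iteratedDeriv 2 f) (C := A) (s := Set.uIcc x y)
      (fun w hw => by
        have h2 := (hd w (hseg w hw).1 1 (by norm_num)).hasDerivAt
        rw [← iteratedDeriv_succ, iteratedDeriv_one] at h2
        exact h2.hasDerivWithinAt)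
      (fun w hw => (hC2 w (hseg w hw).1).trans hA2) (convex_uIcc x y) Set.left_mem_uIcc hz
    exact h.trans (mul_le_mul_of_nonneg_left (hseg z hz).2
      ((le_max_right _ _).trans (le_max_right _ _)))
  -- The mean value inequality for `z ↦ f z - f'(x) z`, whose derivative `hlip` bounds by `A |y -
  -- x|`.
  have h := Convex.norm_image_sub_le_of_norm_hasDerivWithin_le
    (f := fun z => f z - deriv f x * z) (f' := fun z => deriv f z - deriv f x)
    (C := A * |y - x|) (s := Set.uIcc x y)
    (fun w hw => by
      have h2 := (hd w (hseg w hw).1 0 (by norm_num)).hasDerivAt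
      rw [iteratedDeriv_zero] at h2
      have h3 := h2.sub ((hasDerivAt_id w).const_mul (deriv f x))
      rw [mul_one] at h3
      exact h3.hasDerivWithinAt)
    hlip (convex_uIcc x y) Set.left_mem_uIcc Set.right_mem_uIcc
  rw [Real.norm_eq_abs, Real.norm_eq_abs, mul_assoc, ← sq, sq_abs] at h
  refine le_of_eq_of_le ?_ h
  congr 1
  ring

/-! ### Tail and moments of the kernel, and the bias. -/

variable {k : ℝ → ℝ}

theorem IsKernel.le_zero (hk : IsKernel k) (x : ℝ) : k x ≤ k 0 := by
  rcases le_total x 0 with h | h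
  · exact hk.monotoneOn h (Set.mem_Iic.2 le_rfl) h
  · exact hk.antitoneOn (Set.mem_Ici.2 le_rfl) h h

theorem IsKernel.abs_le (hk : IsKernel k) (x : ℝ) : |k x| ≤ k 0 := by
  rw [abs_of_nonneg (hk.nonneg x)]; exact hk.le_zero x

/-- On `[z/2, z]` monotonicity gives `t² k(t) ≥ (z/2)² k(z)`, and that interval has length `z/2`. -/
theorem IsKernel.mul_cube_le (hk : IsKernel k) {z : ℝ} (hz : 0 ≤ z) :
    k z * z ^ 3 ≤ 8 * ∫ x, x ^ 2 * k x := by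
  have h1 : ∫ _ in Set.Icc (z / 2) z, (z / 2) ^ 2 * k z ≤
      ∫ t in Set.Icc (z / 2) z, t ^ 2 * k t := by
    refine setIntegral_mono_on (integrableOn_const (by simp)) hk.integrable_sq.integrableOn
      measurableSet_Icc fun t ht => ?_
    have ht0 : 0 ≤ t := by linarith [ht.1]
    exact mul_le_mul (pow_le_pow_left₀ (by positivity) ht.1 2) (hk.antitoneOn ht0 hz ht.2)
      (hk.nonneg _) (by positivity)
  have h2 : ∫ t in Set.Icc (z / 2) z, t ^ 2 * k t ≤ ∫ x, x ^ 2 * k x :=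
    setIntegral_le_integral hk.integrable_sq
      (Eventually.of_forall fun x => mul_nonneg (sq_nonneg x) (hk.nonneg x))
  have h3 : ∫ _ in Set.Icc (z / 2) z, (z / 2) ^ 2 * k z = k z * z ^ 3 / 8 := by
    rw [setIntegral_const, measureReal_def, Real.volume_Icc,
      ENNReal.toReal_ofReal (by linarith), smul_eq_mul]
    ring
  linarith

theorem IsKernel.mul_abs_cube_le (hk : IsKernel k) (z : ℝ) :
    k z * |z| ^ 3 ≤ 8 * ∫ x, x ^ 2 * k x := by
  rcases abs_cases z with ⟨h, h'⟩ | ⟨h, h'⟩ <;> rw [h]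
  · exact hk.mul_cube_le h'
  · rw [← hk.symm z]
    exact hk.mul_cube_le (by linarith)

theorem IsKernel.integrable_mul (hk : IsKernel k) : Integrable fun z => z * k z := by
  refine (hk.integrable.add hk.integrable_sq).mono'
    (measurable_id.aestronglyMeasurable.mul hk.integrable.aestronglyMeasurable)
    (Eventually.of_forall fun z => ?_)
  rw [norm_mul, Real.norm_eq_abs, Real.norm_eq_abs, abs_of_nonneg (hk.nonneg z)]
  have h1 : |z| ≤ 1 + z ^ 2 := by nlinarith [sq_abs z, sq_nonneg (|z| - 1)]
  have := mul_le_mul_of_nonneg_right h1 (hk.nonneg z)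
  simp only [Pi.add_apply]
  linarith

theorem IsKernel.integral_mul (hk : IsKernel k) : ∫ z, z * k z = 0 := by
  have h := integral_neg_eq_self (fun z => z * k z) volume
  simp only [hk.symm, neg_mul, integral_neg] at h
  linarith

/-- The bias of a kernel density estimator is of the order of the square of the bandwidth,
uniformly on compact intervals on which the density is smooth. -/
theorem IsKernel.exists_bias_le (hk : IsKernel k) {f : ℝ → ℝ} {a b : ℝ}
    (hf : ∀ x ∈ Set.Icc a b, FourTimesDifferentiableAt f x) (hf0 : ∀ x, 0 ≤ f x)
    (hfi : Integrable f) :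
    ∃ C, 0 ≤ C ∧ ∀ h > 0, ∀ x ∈ Set.Icc a b,
      |1 / h * (∫ y, k ((x - y) / h) * f y) - f x| ≤ C * h ^ 2 := by
  obtain ⟨δ, hδ, A, hA, hT⟩ := exists_taylor_bound hf
  set m := ∫ x, x ^ 2 * k x with hm
  have hm0 : 0 < m := hk.second_moment_pos
  have hI0 : 0 ≤ ∫ y, f y := integral_nonneg hf0
  -- For `|y - x| > δ` the extra terms absorb `|f x| ≤ A (y-x)²/δ²` and `|f'(x)(y-x)| ≤ A (y-x)²/δ`.
  set B := A + (A / δ ^ 2 + A / δ) with hB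
  have hB0 : 0 ≤ B := by positivity
  refine ⟨B * m + 8 * m / δ ^ 3 * ∫ y, f y, by positivity, fun h hh x hx => ?_⟩
  obtain ⟨hx0, hx1, hx2⟩ := hT x hx
  set E : ℝ → ℝ := fun y => f y - f x - deriv f x * (y - x) with hE
  have hki : Integrable fun y => k ((x - y) / h) := integrable_comp_sub_div hk.integrable x hh
  have hkf : Integrable fun y => k ((x - y) / h) * f y :=
    hfi.bdd_mul (c := k 0) hki.aestronglyMeasurable
      (Eventually.of_forall fun y => hk.abs_le _)
  have hk1 : Integrable fun y => (x - y) / h * k ((x - y) / h) :=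
    integrable_comp_sub_div hk.integrable_mul x hh
  have hk2 : Integrable fun y => ((x - y) / h) ^ 2 * k ((x - y) / h) :=
    integrable_comp_sub_div (κ := fun z => z ^ 2 * k z) hk.integrable_sq x hh
  -- The constant Taylor term integrates to `f x`, and the linear one to 0 by the symmetry of `k`,
  -- so only the remainder `E` is left.
  have hrep : 1 / h * (∫ y, k ((x - y) / h) * f y) - f x
      = 1 / h * ∫ y, k ((x - y) / h) * E y := by
    have h1 : ∀ y, k ((x - y) / h) * E y = k ((x - y) / h) * f y - k ((x - y) / h) * f x
        + (deriv f x * h) * ((x - y) / h * k ((x - y) / h)) := by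
      intro y
      simp only [hE]
      field_simp
      ring
    have h2 : Integrable fun y => k ((x - y) / h) * f y - k ((x - y) / h) * f x :=
      hkf.sub (hki.mul_const _)
    simp_rw [h1]
    rw [integral_add h2 (hk1.const_mul _),
      integral_sub hkf (hki.mul_const _), integral_mul_const, integral_const_mul,
      integral_comp_sub_div_eq k x hh, integral_comp_sub_div_eq (fun z => z * k z) x hh,
      hk.integral_eq_one, hk.integral_mul]
    field_simp
    ring
  have hpt : ∀ y, |k ((x - y) / h) * E y| ≤
      B * h ^ 2 * (((x - y) / h) ^ 2 * k ((x - y) / h)) + 8 * m * h ^ 3 / δ ^ 3 * f y := by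
    intro y
    have hk0 := hk.nonneg ((x - y) / h)
    have hsq : B * h ^ 2 * (((x - y) / h) ^ 2 * k ((x - y) / h))
        = k ((x - y) / h) * (B * (y - x) ^ 2) := by
      field_simp
      ring
    rw [hsq, abs_mul, abs_of_nonneg hk0]
    rcases le_or_gt |y - x| δ with hy | hy
    · have h1 : |E y| ≤ B * (y - x) ^ 2 := (hx2 y hy).trans
        (mul_le_mul_of_nonneg_right (by rw [hB]; linarith [show 0 ≤ A / δ ^ 2 + A / δ by positivity])
          (sq_nonneg _))
      have h2 : 0 ≤ 8 * m * h ^ 3 / δ ^ 3 * f y := mul_nonneg (by positivity) (hf0 y)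
      linarith [mul_le_mul_of_nonneg_left h1 hk0]
    · have hy1 : 1 ≤ |y - x| / δ := (one_le_div hδ).2 hy.le
      have h3 : |y - x| ≤ (y - x) ^ 2 / δ := by
        rw [← sq_abs, sq, mul_div_assoc]
        exact le_mul_of_one_le_right (abs_nonneg _) hy1
      have h4 : 1 ≤ (y - x) ^ 2 / δ ^ 2 := by
        rw [← sq_abs, ← div_pow]
        exact one_le_pow₀ hy1
      have h5 : |E y| ≤ f y + B * (y - x) ^ 2 := by
        have e1 : |E y| ≤ |f y| + |f x| + |deriv f x * (y - x)| :=
          (abs_sub _ _).trans (add_le_add (abs_sub _ _) le_rfl)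
        rw [abs_mul, abs_of_nonneg (hf0 y)] at e1
        have e2 : |deriv f x| * |y - x| ≤ A * ((y - x) ^ 2 / δ) :=
          mul_le_mul hx1 h3 (abs_nonneg _) hA
        have e3 : |f x| ≤ A * ((y - x) ^ 2 / δ ^ 2) := hx0.trans (le_mul_of_one_le_right hA h4)
        have e4 : B * (y - x) ^ 2 = A * (y - x) ^ 2 + A * ((y - x) ^ 2 / δ ^ 2) +
          A * ((y - x) ^ 2 / δ) := by rw [hB]; ring
        have e5 : 0 ≤ A * (y - x) ^ 2 := by positivity
        linarith
      -- The far mass of `f` is multiplied by `O(h³)`, hence contributes `O(h²)` after division by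
      -- `h`.
      have h6 : k ((x - y) / h) ≤ 8 * m * h ^ 3 / δ ^ 3 := by
        rw [le_div_iff₀ (by positivity)]
        have e1 := hk.mul_abs_cube_le ((x - y) / h)
        rw [abs_div, abs_of_pos hh, div_pow, abs_sub_comm, ← mul_div_assoc,
          div_le_iff₀ (by positivity)] at e1
        exact (mul_le_mul_of_nonneg_left (pow_le_pow_left₀ hδ.le hy.le 3) hk0).trans e1
      calc k ((x - y) / h) * |E y| ≤ k ((x - y) / h) * (f y + B * (y - x) ^ 2) :=
            mul_le_mul_of_nonneg_left h5 hk0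
        _ = k ((x - y) / h) * (B * (y - x) ^ 2) + k ((x - y) / h) * f y := by ring
        _ ≤ _ := by
          have := mul_le_mul_of_nonneg_right h6 (hf0 y)
          linarith
  rw [hrep, abs_mul, abs_of_pos (by positivity : 0 < 1 / h)]
  have hle : |∫ y, k ((x - y) / h) * E y| ≤
      B * h ^ 2 * (h * m) + 8 * m * h ^ 3 / δ ^ 3 * ∫ y, f y := by
    refine abs_integral_le_integral_abs.trans ?_
    refine (integral_mono_of_nonneg (Eventually.of_forall fun _ => abs_nonneg _)
      ((hk2.const_mul _).add (hfi.const_mul _)) (Eventually.of_forall hpt)).trans (le_of_eq ?_)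
    simp only [Pi.add_apply]
    rw [integral_add (hk2.const_mul _) (hfi.const_mul _), integral_const_mul, integral_const_mul,
      integral_comp_sub_div_eq (fun z => z ^ 2 * k z) x hh]
  calc 1 / h * |∫ y, k ((x - y) / h) * E y|
      ≤ 1 / h * (B * h ^ 2 * (h * m) + 8 * m * h ^ 3 / δ ^ 3 * ∫ y, f y) :=
        mul_le_mul_of_nonneg_left hle (by positivity)
    _ = _ := by field_simp

variable {s : ℕ} {g : (Fin s → ℝ) → ℝ} {f : ℝ → ℝ}

theorem HasDensity.integrable (hgf : HasDensity g f) : Integrable f := by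
  have hprob : IsProbabilityMeasure (volume.withDensity fun x => ENNReal.ofReal (f x)) :=
    hgf.hasLaw.isProbabilityMeasure_iff.1 inferInstance
  have h1 : ∫⁻ x, ENNReal.ofReal (f x) = 1 := by
    have := hprob.measure_univ
    rwa [withDensity_apply _ MeasurableSet.univ, Measure.restrict_univ] at this
  refine ⟨hgf.measurable.aestronglyMeasurable, ?_⟩
  rw [hasFiniteIntegral_iff_ofReal (Eventually.of_forall hgf.nonneg), h1]
  exact ENNReal.one_lt_top

theorem HasDensity.integral_comp (hgf : HasDensity g f) {κ : ℝ → ℝ} (hκ : Measurable κ) :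
    ∫ u, κ (g u) ∂uniformCube s = ∫ y, κ y * f y := by
  have h := hgf.hasLaw.integral_comp (f := κ) hκ.aestronglyMeasurable
  rw [Function.comp_def] at h
  rw [h, integral_withDensity_eq_integral_toReal_smul hgf.measurable.ennreal_ofReal
    (Eventually.of_forall fun _ => ENNReal.ofReal_lt_top)]
  refine integral_congr_ae (Eventually.of_forall fun y => ?_)
  simp only [ENNReal.toReal_ofReal (hgf.nonneg y), smul_eq_mul, mul_comm]

end Bias

/-! ### Rates of convergence -/

section Rates

variable {Ω : Type*} [MeasurableSpace Ω] {μ : Measure Ω}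
  {s : ℕ} {k f : ℝ → ℝ} {g : (Fin s → ℝ) → ℝ} {P : (n : ℕ) → Fin n → Ω → (Fin s → ℝ)}

/-- The faces `u j = 1` are null; the half-open boxes of the discrepancy miss their points. -/
theorem ae_uniformCube_mem_Ico : ∀ᵐ u ∂uniformCube s, ∀ j, u j ∈ Set.Ico (0 : ℝ) 1 := by
  have h : ∀ᵐ u ∂uniformCube s, ∀ j, u j ≠ 1 :=
    ae_restrict_of_ae (ae_all_iff.2 fun j => by rw [volume_pi]; exact Measure.ae_eval_ne _ j 1)
  filter_upwards [h, ae_uniformCube_mem] with u hu hc j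
  exact ⟨(mem_cube_iff.1 hc j).1, lt_of_le_of_ne (mem_cube_iff.1 hc j).2 (hu j)⟩

theorem IsLowDiscrepancyRQMC.ae_mem_Ico (hP : IsLowDiscrepancyRQMC μ P) (n : ℕ) :
    ∀ᵐ ω ∂μ, ∀ i j, P n i ω j ∈ Set.Ico (0 : ℝ) 1 := by
  rw [ae_all_iff]
  intro i
  have hm := (hP.hasLaw n i).aemeasurable
  have h := ae_uniformCube_mem_Ico (s := s)
  rw [← (hP.hasLaw n i).map_eq] at h
  exact ae_of_ae_map hm h

theorem IsLowDiscrepancyRQMC.aemeasurable_kde (hP : IsLowDiscrepancyRQMC μ P)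
    (hgf : HasDensity g f) (hk : Measurable k) (n : ℕ) (h x : ℝ) :
    AEMeasurable (fun ω => kde k h (fun i => g (P n i ω)) x) μ := by
  unfold kde
  refine (Finset.aemeasurable_fun_sum _ fun i _ => ?_).const_mul _
  have h1 := (hgf.hasLaw.fun_comp (hP.hasLaw n i)).aemeasurable
  exact hk.comp_aemeasurable ((h1.const_sub x).div_const h)

/-- The almost sure error of the estimator with respect to its mean. -/
theorem IsLowDiscrepancyRQMC.exists_abs_kde_sub_le (hP : IsLowDiscrepancyRQMC μ P)
    (hg : IsRegularMap g) (hk : IsSmoothKernel s k) {ε : ℝ} (hε : 0 < ε) :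
    ∃ K, 0 ≤ K ∧ ∀ n : ℕ, 1 ≤ n → ∀ h ∈ Set.Ioc (0 : ℝ) 1, ∀ x, ∀ᵐ ω ∂μ,
      |kde k h (fun i => g (P n i ω)) x - 1 / h * ∫ u, k ((x - g u) / h) ∂uniformCube s|
        ≤ K * (n : ℝ) ^ (-1 + ε) * h⁻¹ ^ s := by
  obtain ⟨C, hC0, hC⟩ := hg.exists_abs_kde_sub_le hk
  obtain ⟨K, hK⟩ := hP.discrepancy ε hε
  refine ⟨C * max K 0, by positivity, fun n hn h hh x => ?_⟩
  filter_upwards [hK n hn, hP.ae_mem_Ico n] with ω hω hmem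
  refine (hC n hn h hh x _ hmem).trans ?_
  have h0 := hh.1
  refine mul_le_mul_of_nonneg_right ?_ (by positivity)
  rw [mul_assoc]
  exact mul_le_mul_of_nonneg_left (hω.trans (mul_le_mul_of_nonneg_right (le_max_left _ _)
    (by positivity))) hC0

/-! ### From almost sure errors to variance and mean square error. -/

variable [IsProbabilityMeasure μ]

/-- The mean of `X` is also within `R` of `c`, whence the factor 2; `c` need not be identified with
that mean. -/
theorem evariance_le_of_abs_sub_le {X : Ω → ℝ} (hX : AEMeasurable X μ) {c R : ℝ}
    (h : ∀ᵐ ω ∂μ, |X ω - c| ≤ R) : evariance X μ ≤ ENNReal.ofReal ((2 * R) ^ 2) := by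
  have hY : Integrable (fun ω => X ω - c) μ :=
    Integrable.of_bound (hX.sub_const c).aestronglyMeasurable R h
  have hXi : Integrable X μ := by
    refine (hY.add (integrable_const c)).congr (Eventually.of_forall fun ω => ?_)
    simp
  have hmean : |∫ ω, X ω ∂μ - c| ≤ R := by
    have h1 := norm_integral_le_of_norm_le_const (μ := μ) (f := fun ω => X ω - c) h
    rw [integral_sub hXi (integrable_const c)] at h1
    simpa using h1
  have hle : evariance X μ ≤ ∫⁻ _, ENNReal.ofReal ((2 * R) ^ 2) ∂μ := by
    refine lintegral_mono_ae ?_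
    filter_upwards [h] with ω hω
    rw [Real.enorm_eq_ofReal_abs, ← ENNReal.ofReal_pow (abs_nonneg _)]
    refine ENNReal.ofReal_le_ofReal (pow_le_pow_left₀ (abs_nonneg _) ?_ 2)
    have := abs_sub_le (X ω) c (∫ ω, X ω ∂μ)
    rw [abs_sub_comm c] at this
    linarith
  simpa using hle

theorem natCast_rpow_sq (n : ℕ) (e : ℝ) : ((n : ℝ) ^ e) ^ 2 = (n : ℝ) ^ (2 * e) := by
  rw [← Real.rpow_natCast, ← Real.rpow_mul (Nat.cast_nonneg n)]
  push_cast
  rw [mul_comm]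

theorem integratedVariance_rate (hg : IsRegularMap g) (hgf : HasDensity g f)
    (hk : IsSmoothKernel s k) (hP : IsLowDiscrepancyRQMC μ P) (a b : ℝ) {ε : ℝ}
    (hε : 0 < ε) : ∃ K : ℝ, ∀ n : ℕ, 1 ≤ n → ∀ h ∈ Set.Ioc (0 : ℝ) 1,
      integratedVariance μ k g a b (P n) h ≤
        ENNReal.ofReal (K * (n : ℝ) ^ (-2 + ε) * h ^ (-2 * (s : ℝ))) := by
  -- Squaring doubles the exponent, hence `ε / 2`.
  obtain ⟨K, hK0, hK⟩ := hP.exists_abs_kde_sub_le hg hk (half_pos hε)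
  refine ⟨4 * K ^ 2 * (b - a), fun n hn h hh => ?_⟩
  have h0 := hh.1
  have hle : integratedVariance μ k g a b (P n) h ≤ ∫⁻ _ in Set.Icc a b,
      ENNReal.ofReal ((2 * (K * (n : ℝ) ^ (-1 + ε / 2) * h⁻¹ ^ s)) ^ 2) :=
    lintegral_mono fun x => evariance_le_of_abs_sub_le
      (hP.aemeasurable_kde hgf hk.contDiff.continuous.measurable n h x) (hK n hn h hh x)
  refine hle.trans (le_of_eq ?_)
  rw [setLIntegral_const, Real.volume_Icc, ← ENNReal.ofReal_mul (by positivity)]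
  congr 1
  have h1 : (h⁻¹ ^ s) ^ 2 = h ^ (-2 * (s : ℝ)) := by
    rw [← pow_mul, inv_pow, ← Real.rpow_natCast, ← Real.rpow_neg h0.le]
    push_cast
    ring_nf
  rw [mul_pow, mul_pow, mul_pow, h1, natCast_rpow_sq]
  ring_nf

theorem meanIntegratedSquareError_le (hg : IsRegularMap g) (hgf : HasDensity g f)
    (hk : IsKernel k) (hks : IsSmoothKernel s k) (hP : IsLowDiscrepancyRQMC μ P) {a b : ℝ}
    (hab : a < b) (hf : IsSmoothDensityOn a b f) {ε : ℝ} (hε : 0 < ε) :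
    ∃ K, 0 ≤ K ∧ ∀ n : ℕ, 1 ≤ n → ∀ h ∈ Set.Ioc (0 : ℝ) 1,
      meanIntegratedSquareError μ k g f a b (P n) h ≤
        ENNReal.ofReal (K * ((n : ℝ) ^ (-2 + ε) * (h⁻¹ ^ s) ^ 2 + h ^ 4)) := by
  obtain ⟨K, hK0, hK⟩ := hP.exists_abs_kde_sub_le hg hks (half_pos hε)
  obtain ⟨C, hC0, hC⟩ := hk.exists_bias_le hf.differentiable hgf.nonneg hgf.integrable
  refine ⟨2 * (K ^ 2 + C ^ 2) * (b - a),
    mul_nonneg (by positivity) (sub_nonneg.2 hab.le), fun n hn h hh => ?_⟩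
  have h0 := hh.1
  set R := K * (n : ℝ) ^ (-1 + ε / 2) * h⁻¹ ^ s with hR
  have hle : meanIntegratedSquareError μ k g f a b (P n) h ≤ ∫⁻ _ in Set.Icc a b,
      ENNReal.ofReal (2 * R ^ 2 + 2 * (C * h ^ 2) ^ 2) := by
    refine setLIntegral_mono' measurableSet_Icc fun x hx => ?_
    have hbias := hC h h0 x hx
    rw [← hgf.integral_comp (κ := fun y => k ((x - y) / h))
      (hks.contDiff.continuous.measurable.comp (by fun_prop))] at hbias
    have hin : ∫⁻ ω, ENNReal.ofReal ((kde k h (fun i => g (P n i ω)) x - f x) ^ 2) ∂μ ≤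
        ∫⁻ _, ENNReal.ofReal (2 * R ^ 2 + 2 * (C * h ^ 2) ^ 2) ∂μ := by
      refine lintegral_mono_ae ?_
      filter_upwards [hK n hn h hh x] with ω hω
      refine ENNReal.ofReal_le_ofReal ?_
      have h1 := sq_le_sq' (abs_le.1 hω).1 (abs_le.1 hω).2
      have h2 := sq_le_sq' (abs_le.1 hbias).1 (abs_le.1 hbias).2
      set c := 1 / h * ∫ u, k ((x - g u) / h) ∂uniformCube s
      set X := kde k h (fun i => g (P n i ω)) x
      -- Splits the error into the deviation from `c`, which is `O(n^{-1+ε/2} h^{-s})`, and the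
      -- bias, which is `O(h²)`.
      have h3 : (X - f x) ^ 2 ≤ 2 * (X - c) ^ 2 + 2 * (c - f x) ^ 2 := by
        nlinarith [sq_nonneg ((X - c) - (c - f x))]
      linarith
    simpa using hin
  refine hle.trans ?_
  rw [setLIntegral_const, Real.volume_Icc, ← ENNReal.ofReal_mul (by positivity)]
  refine ENNReal.ofReal_le_ofReal ?_
  rw [mul_right_comm]
  refine mul_le_mul_of_nonneg_right ?_ (sub_nonneg.2 hab.le)
  have hn2 : 2 * (-1 + ε / 2) = -2 + ε := by ring
  rw [hR, mul_pow, mul_pow, natCast_rpow_sq, hn2]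
  have e1 : 0 ≤ C ^ 2 * ((n : ℝ) ^ (-2 + ε) * (h⁻¹ ^ s) ^ 2) := by positivity
  have e2 : 0 ≤ K ^ 2 * h ^ 4 := by positivity
  nlinarith

/-- Serves the finitely many `n` for which `h n` may exceed 1 and the rate bound does not apply;
there finiteness is enough. -/
theorem meanIntegratedSquareError_ne_top (hk : IsKernel k) {a b : ℝ}
    (hf : IntegrableOn (fun x => f x ^ 2) (Set.Icc a b)) {n : ℕ}
    (p : Fin n → Ω → (Fin s → ℝ)) (h : ℝ) :
    meanIntegratedSquareError μ k g f a b p h ≠ ⊤ := by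
  set D := |1 / (n * h)| * (n * k 0) with hD
  have hkde : ∀ x ω, |kde k h (fun i => g (p i ω)) x| ≤ D := by
    intro x ω
    rw [kde, abs_mul]
    refine mul_le_mul_of_nonneg_left ?_ (abs_nonneg _)
    refine (Finset.abs_sum_le_sum_abs _ _).trans ?_
    refine (Finset.sum_le_sum fun i _ => hk.abs_le _).trans ?_
    simp
  have hint : IntegrableOn (fun x => 2 * D ^ 2 + 2 * f x ^ 2) (Set.Icc a b) :=
    (integrableOn_const (by simp)).add (hf.const_mul 2)
  have hle : meanIntegratedSquareError μ k g f a b p h ≤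
      ∫⁻ x in Set.Icc a b, ENNReal.ofReal (2 * D ^ 2 + 2 * f x ^ 2) := by
    refine lintegral_mono fun x => ?_
    have hin : ∫⁻ ω, ENNReal.ofReal ((kde k h (fun i => g (p i ω)) x - f x) ^ 2) ∂μ ≤
        ∫⁻ _, ENNReal.ofReal (2 * D ^ 2 + 2 * f x ^ 2) ∂μ := by
      refine lintegral_mono fun ω => ENNReal.ofReal_le_ofReal ?_
      have h1 := sq_le_sq' (abs_le.1 (hkde x ω)).1 (abs_le.1 (hkde x ω)).2
      nlinarith [sq_nonneg (kde k h (fun i => g (p i ω)) x + f x)]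
    simpa using hin
  refine ne_top_of_le_ne_top ?_ hle
  rw [← ofReal_integral_eq_lintegral_ofReal hint (Eventually.of_forall fun x => by positivity)]
  exact ENNReal.ofReal_ne_top

theorem exists_bound_of_eventually_le_rpow {m : ℕ → ENNReal} {e K₀ : ℝ}
    (hfin : ∀ n, m n ≠ ⊤)
    (hm : ∀ᶠ n : ℕ in atTop, m n ≤ ENNReal.ofReal (K₀ * (n : ℝ) ^ e)) :
    ∃ K : ℝ, ∀ n : ℕ, 1 ≤ n → m n ≤ ENNReal.ofReal (K * (n : ℝ) ^ e) := by
  obtain ⟨N, hN⟩ := eventually_atTop.1 hm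
  have hnn : ∀ i : ℕ, 0 ≤ (m i).toReal * (i : ℝ) ^ (-e) := fun i => by positivity
  -- Each early value, divided by its own `i^e`, is dominated by the sum of all of them.
  refine ⟨max K₀ (∑ i ∈ Finset.range N, (m i).toReal * (i : ℝ) ^ (-e)), fun n hn => ?_⟩
  have hn0 : (0 : ℝ) < n := by exact_mod_cast hn
  rcases le_or_gt N n with h | h
  · exact (hN n h).trans (ENNReal.ofReal_le_ofReal
      (mul_le_mul_of_nonneg_right (le_max_left _ _) (by positivity)))
  · rw [← ENNReal.ofReal_toReal (hfin n)]
    refine ENNReal.ofReal_le_ofReal ?_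
    calc (m n).toReal = (m n).toReal * (n : ℝ) ^ (-e) * (n : ℝ) ^ e := by
          rw [mul_assoc, ← Real.rpow_add hn0, neg_add_cancel, Real.rpow_zero, mul_one]
      _ ≤ _ := mul_le_mul_of_nonneg_right ((Finset.single_le_sum
          (f := fun i : ℕ => (m i).toReal * (i : ℝ) ^ (-e)) (fun i _ => hnn i)
          (Finset.mem_range.2 h)).trans (le_max_right _ _)) (by positivity)

/-- The bandwidth balances the two terms: `-2 + 2s/(2+s) = -4/(2+s)`. -/
theorem meanIntegratedSquareError_rate (hg : IsRegularMap g) (hgf : HasDensity g f)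
    (hk : IsKernel k) (hks : IsSmoothKernel s k) (hP : IsLowDiscrepancyRQMC μ P) {a b : ℝ}
    (hab : a < b) (hf : IsSmoothDensityOn a b f) {h : ℕ → ℝ} (hpos : ∀ n, 1 ≤ n → 0 < h n)
    (hh : h =Θ[atTop] fun n : ℕ => (n : ℝ) ^ (-1 / (2 + (s : ℝ)))) {ε : ℝ} (hε : 0 < ε) :
    ∃ K : ℝ, ∀ n : ℕ, 1 ≤ n → meanIntegratedSquareError μ k g f a b (P n) (h n) ≤
      ENNReal.ofReal (K * (n : ℝ) ^ (-4 / (2 + (s : ℝ)) + ε)) := by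
  obtain ⟨K, hK0, hK⟩ := meanIntegratedSquareError_le hg hgf hk hks hP hab hf hε
  obtain ⟨c₁, hc₁, hO₁⟩ := hh.1.exists_pos
  obtain ⟨c₂, hc₂, hO₂⟩ := hh.2.exists_pos
  have hs0 : (0 : ℝ) < 2 + s := by positivity
  have hlim : Tendsto (fun n : ℕ => c₁ * (n : ℝ) ^ (-1 / (2 + (s : ℝ)))) atTop (𝓝 0) := by
    have h1 := (tendsto_rpow_neg_atTop (y := 1 / (2 + (s : ℝ))) (by positivity)).comp
      tendsto_natCast_atTop_atTop
    simpa [Function.comp_def, neg_div] using h1.const_mul c₁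
  refine exists_bound_of_eventually_le_rpow (K₀ := K * ((c₂ ^ s) ^ 2 + c₁ ^ 4))
    (fun n => meanIntegratedSquareError_ne_top hk
      (by simpa using hf.roughness 0 (by norm_num)) _ _) ?_
  filter_upwards [eventually_ge_atTop 1, hO₁.bound, hO₂.bound,
    hlim.eventually_le_const zero_lt_one] with n hn hb₁ hb₂ hsmall
  have hn1 : (1 : ℝ) ≤ n := by exact_mod_cast hn
  have hn0 : (0 : ℝ) < n := by linarith
  have hhn := hpos n hn
  set r := (n : ℝ) ^ (-1 / (2 + (s : ℝ))) with hr
  have hr0 : 0 < r := by positivity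
  rw [Real.norm_of_nonneg hhn.le, Real.norm_of_nonneg hr0.le] at hb₁ hb₂
  refine (hK n hn (h n) ⟨hhn, hb₁.trans hsmall⟩).trans (ENNReal.ofReal_le_ofReal ?_)
  rw [mul_assoc]
  refine mul_le_mul_of_nonneg_left ?_ hK0
  -- The lower half of `Θ` controls the variance term; the upper half, with `c₁`, controls the bias
  -- and forces `h n ≤ 1` eventually.
  have hinv : (h n)⁻¹ ≤ c₂ * r⁻¹ := by
    rw [inv_le_iff_one_le_mul₀ hhn, mul_right_comm, ← div_eq_mul_inv, one_le_div hr0]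
    exact hb₂
  have hrpow : ∀ m : ℕ, r ^ m = (n : ℝ) ^ (-(m : ℝ) / (2 + s)) := by
    intro m
    rw [hr, ← Real.rpow_natCast, ← Real.rpow_mul hn0.le]
    congr 1
    ring
  rw [add_mul]
  refine add_le_add ?_ ?_
  · calc (n : ℝ) ^ (-2 + ε) * ((h n)⁻¹ ^ s) ^ 2
        ≤ (n : ℝ) ^ (-2 + ε) * ((c₂ * r⁻¹) ^ s) ^ 2 := by gcongr
      _ = (c₂ ^ s) ^ 2 * ((n : ℝ) ^ (-2 + ε) * (r ^ (s * 2))⁻¹) := by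
          rw [mul_pow, mul_pow, inv_pow, inv_pow, ← pow_mul r]; ring
      _ = _ := by
          rw [hrpow, ← Real.rpow_neg hn0.le, ← Real.rpow_add hn0]
          congr 2
          push_cast
          field_simp
          ring
  · calc h n ^ 4 ≤ (c₁ * r) ^ 4 := pow_le_pow_left₀ hhn.le hb₁ 4
      _ = c₁ ^ 4 * (n : ℝ) ^ (-4 / (2 + (s : ℝ))) := by
          rw [mul_pow, hrpow]; norm_num
      _ ≤ _ := mul_le_mul_of_nonneg_left
          (Real.rpow_le_rpow_of_exponent_le hn1 (by linarith)) (by positivity)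

theorem neg_four_div_lt_iff (s : ℕ) : -4 / (2 + (s : ℝ)) < -4 / 5 ↔ s < 3 := by
  have hs0 : (0 : ℝ) < 2 + s := by positivity
  rw [div_lt_div_iff₀ hs0 (by norm_num), ← Nat.cast_lt (α := ℝ)]
  push_cast
  constructor <;> intro h <;> linarith

theorem neg_four_div_eq_iff (s : ℕ) : -4 / (2 + (s : ℝ)) = -4 / 5 ↔ s = 3 := by
  have hs0 : (0 : ℝ) < 2 + s := by positivity
  rw [div_eq_div_iff hs0.ne' (by norm_num), ← Nat.cast_inj (R := ℝ)]
  push_cast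
  constructor <;> intro h <;> linarith

end Rates

theorem corollary4p2 {Ω : Type*} [MeasurableSpace Ω] (μ : Measure Ω) [IsProbabilityMeasure μ]
    (s : ℕ) (hs : 1 ≤ s) (a b : ℝ) (hab : a < b)
    (k f : ℝ → ℝ) (g : (Fin s → ℝ) → ℝ)
    (hk : IsKernel k) (hks : IsSmoothKernel s k)
    (hg : IsRegularMap g) (hgf : HasDensity g f) (hf : IsSmoothDensityOn a b f)
    (P : (n : ℕ) → Fin n → Ω → (Fin s → ℝ)) (hP : IsLowDiscrepancyRQMC μ P) :
    -- the integrated variance is `O(n^{-2+ε} h^{-2s})`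
    (∀ ε > (0 : ℝ), ∃ K : ℝ, ∀ n : ℕ, 1 ≤ n → ∀ h ∈ Set.Ioc (0 : ℝ) 1,
      integratedVariance μ k g a b (P n) h ≤
        ENNReal.ofReal (K * (n : ℝ) ^ (-2 + ε) * h ^ (-2 * (s : ℝ)))) ∧
    -- with `h = Θ(n^{-1/(2+s)})`, the mean integrated square error is `O(n^{-4/(2+s)+ε})`
    (∀ h : ℕ → ℝ, (∀ n, 1 ≤ n → 0 < h n) →
      h =Θ[atTop] (fun n : ℕ => (n : ℝ) ^ (-1 / (2 + (s : ℝ)))) →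
      (∀ ε > (0 : ℝ), ∃ K : ℝ, ∀ n : ℕ, 1 ≤ n →
        meanIntegratedSquareError μ k g f a b (P n) (h n) ≤
          ENNReal.ofReal (K * (n : ℝ) ^ (-4 / (2 + (s : ℝ)) + ε))) ∧
      -- for `s < 3` this is a better rate than `n^{-4/5}`
      (s < 3 → ∃ δ > (0 : ℝ), ∃ K : ℝ, ∀ n : ℕ, 1 ≤ n →
        meanIntegratedSquareError μ k g f a b (P n) (h n) ≤
          ENNReal.ofReal (K * (n : ℝ) ^ (-4 / 5 - δ)))) ∧
    -- comparison of the exponent with the exponent `-4/5`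
    (-4 / (2 + (s : ℝ)) < -4 / 5 ↔ s < 3) ∧
    (-4 / (2 + (s : ℝ)) = -4 / 5 ↔ s = 3) := by
  refine ⟨fun ε hε => integratedVariance_rate hg hgf hks hP a b hε, fun h hpos hh => ⟨fun ε hε =>
    meanIntegratedSquareError_rate hg hgf hk hks hP hab hf hpos hh hε, fun hs3 => ?_⟩,
    neg_four_div_lt_iff s, neg_four_div_eq_iff s⟩
  have hgap := (neg_four_div_lt_iff s).2 hs3
  -- `δ` is half the gap between the exponents: one half is spent as the `ε` of the rate, the other
  -- is the gain over `-4/5`.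
  have hδ : 0 < (-4 / 5 - -4 / (2 + (s : ℝ))) / 2 := by linarith
  refine ⟨_, hδ, ?_⟩
  have he : (-4 / 5 - (-4 / 5 - -4 / (2 + (s : ℝ))) / 2 : ℝ)
      = -4 / (2 + (s : ℝ)) + (-4 / 5 - -4 / (2 + (s : ℝ))) / 2 := by ring
  rw [he]
  exact meanIntegratedSquareError_rate hg hgf hk hks hP hab hf hpos hh hδ
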